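/- Let $\|\cdot\|_F$ be the Frobenius norm. For $\Delta>0$ call two matrices $V,V'\in\mathbb R^{n\times m}$ *adjacent* if $\|VV^{\top}-V'V'^{\top}\|_F\le\Delta$. A randomized algorithm $\mathcal M$ on $\mathbb R^{n\times m}$ with output in $\mathbb R^{n\times n}$ is *$(\epsilon,\delta)$-differentially private* if $\mathbb P[\mathcal M(V)\in S]\le e^{\epsilon}\,\mathbb P[\mathcal M(V')\in S]+\delta$ for all adjacent $V,V'\in\mathbb R^{n\times m}$ and all measurable $S\subseteq\mathbb R^{n\times n}$. **Theorem.** There are an absolute constant $C$, a polynomial $p$, and a single randomized algorithm that takes as input integers $n,m\ge 0$, parameters $0<\epsilon\le 1$, $0<\delta\le 1$, $\Delta>0$ and a matrix $V\in\mathbb R^{n\times m}$, and outputs a random matrix $\hat{\mathbf X}\in\mathbb R^{n\times n}$, such that for all $n,m,\epsilon,\delta,\Delta$: 1. (privacy) the map $V\mapsto\hat{\mathbf X}$ is $(\epsilon,\delta)$-differentially private; 2. (utility) if the rows of $V$ are unit vectors, then $$\mathbb E\,\big\|VV^{\top}-\hat{\mathbf X}\big\|_F^2\;\le\; C\cdot\frac{\Delta\sqrt{\log(2/\delta)}}{\epsilon}\cdot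 n^{3/2};$$ 3. (running time) on every input and for every outcome of its random draws, the algorithm performs at most $p(n+m)$ basic operations. Here the algorithm is a program for a random-access machine over the real numbers, whose basic operations, each of unit cost, are $+,-,\times,\div,\sqrt{\cdot},\log$ and comparison of real numbers, index arithmetic ($+$, truncated $-$, $\times$ on natural numbers), memory access, and drawing an independent standard Gaussian; its only built-in constants are natural numbers. -/

import Mathlib

open MeasureTheory ProbabilityTheory
open scoped Matrix Matrix.Norms.Frobenius

/-! ### A randomized real RAM with unit-cost arithmetic

Programs are written in a small structured language. Memory consists of natural-number registers
(used for indices and loop bounds) and of two-dimensional arrays of real numbers. The basic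
operations are `+`, `-`, `*`, `/`, `√`, `log` and comparison on real numbers, `+`, `-` (truncated)
and `*` on indices, and drawing a fresh standard Gaussian. The only constants are natural numbers,
and there is no conversion from real numbers to indices. Each operation and each memory access
costs one unit of time. -/

namespace RealRAM

/-- Index expressions. -/
inductive IExp : Type
  | lit (k : ℕ)
  | reg (x : ℕ)
  | add (e f : IExp)
  | sub (e f : IExp)
  | mul (e f : IExp)

/-- Real expressions; `cell a i j` is the entry `(i, j)` of the array with name `a`. -/
inductive RExp : Type
  | ofIndex (e : IExp)
  | cell (a : ℕ) (i j : IExp)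
  | add (e f : RExp)
  | sub (e f : RExp)
  | mul (e f : RExp)
  | div (e f : RExp)
  | sqrt (e : RExp)
  | log (e : RExp)

/-- Programs.
* `setIndex x e`: store the value of `e` in register `x`;
* `setCell a i j e`: store the value of `e` in entry `(i, j)` of array `a`;
* `gauss a i j`: store a fresh standard Gaussian in entry `(i, j)` of array `a`;
* `ifLe e f c d`: run `c` if `e ≤ f`, and `d` otherwise;
* `loop x e c`: evaluate `e` once, to `N` say, then run `c` with register `x` set to
  `0, 1, …, N - 1` in turn. -/
inductive Program : Type
  | skip
  | setIndex (x : ℕ) (e : IExp)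
  | setCell (a : ℕ) (i j : IExp) (e : RExp)
  | gauss (a : ℕ) (i j : IExp)
  | seq (c d : Program)
  | ifLe (e f : RExp) (c d : Program)
  | loop (x : ℕ) (e : IExp) (c : Program)

/-- A machine state: the registers, the arrays, the number of Gaussians drawn so far, and the time
spent so far. -/
structure State : Type where
  reg : ℕ → ℕ
  mem : ℕ → ℕ → ℕ → ℝ
  drawn : ℕ
  time : ℕ

namespace State

/-- Let time pass. -/
def tick (s : State) (t : ℕ) : State :=
  { s with time := s.time + t }

/-- Write a register. -/
def setReg (s : State) (x v : ℕ) : State :=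
  { s with reg := Function.update s.reg x v }

/-- Write an array entry. -/
def setMem (s : State) (a i j : ℕ) (v : ℝ) : State :=
  { s with mem := fun a' i' j' => if a' = a ∧ i' = i ∧ j' = j then v else s.mem a' i' j' }

end State

/-- The value of an index expression. -/
def IExp.eval (s : State) : IExp → ℕ
  | lit k => k
  | reg x => s.reg x
  | add e f => e.eval s + f.eval s
  | sub e f => e.eval s - f.eval s
  | mul e f => e.eval s * f.eval s

/-- The time needed to evaluate an index expression. -/
def IExp.cost : IExp → ℕ
  | lit _ => 1
  | reg _ => 1
  | add e f => e.cost + f.cost + 1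
  | sub e f => e.cost + f.cost + 1
  | mul e f => e.cost + f.cost + 1

/-- The value of a real expression. -/
noncomputable def RExp.eval (s : State) : RExp → ℝ
  | ofIndex e => (e.eval s : ℝ)
  | cell a i j => s.mem a (i.eval s) (j.eval s)
  | add e f => e.eval s + f.eval s
  | sub e f => e.eval s - f.eval s
  | mul e f => e.eval s * f.eval s
  | div e f => e.eval s / f.eval s
  | sqrt e => Real.sqrt (e.eval s)
  | log e => Real.log (e.eval s)

/-- The time needed to evaluate a real expression. -/
def RExp.cost : RExp → ℕ
  | ofIndex e => e.cost + 1
  | cell _ i j => i.cost + j.cost + 1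
  | add e f => e.cost + f.cost + 1
  | sub e f => e.cost + f.cost + 1
  | mul e f => e.cost + f.cost + 1
  | div e f => e.cost + f.cost + 1
  | sqrt e => e.cost + 1
  | log e => e.cost + 1

open Classical in
/-- Run a program from a given state, where `ω 0, ω 1, …` are the successive Gaussian draws. -/
noncomputable def Program.run (ω : ℕ → ℝ) : Program → State → State
  | skip, s => s.tick 1
  | setIndex x e, s => (s.setReg x (e.eval s)).tick (e.cost + 1)
  | setCell a i j e, s =>
      (s.setMem a (i.eval s) (j.eval s) (e.eval s)).tick (i.cost + j.cost + e.cost + 1)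
  | gauss a i j, s =>
      { (s.setMem a (i.eval s) (j.eval s) (ω s.drawn)).tick (i.cost + j.cost + 1) with
        drawn := s.drawn + 1 }
  | seq c d, s => d.run ω (c.run ω s)
  | ifLe e f c d, s =>
      if e.eval s ≤ f.eval s then c.run ω (s.tick (e.cost + f.cost + 1))
      else d.run ω (s.tick (e.cost + f.cost + 1))
  | loop x e c, s =>
      (List.range (e.eval s)).foldl (fun t k => c.run ω ((t.setReg x k).tick 1))
        (s.tick (e.cost + 1))

/-- The law of the machine's source of randomness: independent standard Gaussians. -/
noncomputable def randomness : Measure (ℕ → ℝ) :=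
  Measure.infinitePi fun _ : ℕ => gaussianReal 0 1

/-- The initial state on the input `(n, m, ε, δ, Δ, V)`: registers `0` and `1` hold `n` and `m`,
the entries `(0, 0)`, `(0, 1)`, `(0, 2)` of array `0` hold `ε`, `δ`, `Δ`, array `1` holds the
matrix `V`, and everything else is zero. -/
def inputState {n m : ℕ} (ε δ Δ : ℝ) (V : Matrix (Fin n) (Fin m) ℝ) : State where
  reg := fun x => if x = 0 then n else if x = 1 then m else 0
  mem := fun a i j =>
    if a = 0 then
      (if i = 0 then
        (if j = 0 then ε else if j = 1 then δ else if j = 2 then Δ else 0) else 0)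
    else if a = 1 then
      (if h : i < n ∧ j < m then V ⟨i, h.1⟩ ⟨j, h.2⟩ else 0)
    else 0
  drawn := 0
  time := 0

/-- The output: the upper left `n × n` block of array `2` in the final state. -/
noncomputable def Program.output (P : Program) {n m : ℕ} (ε δ Δ : ℝ)
    (V : Matrix (Fin n) (Fin m) ℝ) (ω : ℕ → ℝ) : Matrix (Fin n) (Fin n) ℝ :=
  Matrix.of fun i j => (P.run ω (inputState ε δ Δ V)).mem 2 i j

/-- The running time. -/
noncomputable def Program.runningTime (P : Program) {n m : ℕ} (ε δ Δ : ℝ)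
    (V : Matrix (Fin n) (Fin m) ℝ) (ω : ℕ → ℝ) : ℕ :=
  (P.run ω (inputState ε δ Δ V)).time

end RealRAM

/-! ### Differential privacy -/

/-- The product `σ`-algebra (equivalently, the Borel `σ`-algebra) on matrices. -/
instance instMeasurableSpaceMatrixFin {n : ℕ} : MeasurableSpace (Matrix (Fin n) (Fin n) ℝ) :=
  inferInstanceAs (MeasurableSpace (Fin n → Fin n → ℝ))

/-- Two matrices are `Δ`-adjacent if the Frobenius distance of their Gram matrices is at most
`Δ`. (The norm on matrices is the Frobenius norm.) -/
def GramAdjacent {n m : ℕ} (Δ : ℝ) (V V' : Matrix (Fin n) (Fin m) ℝ) : Prop :=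
  ‖V * Vᵀ - V' * V'ᵀ‖ ≤ Δ

/-- `(ε, δ)`-differential privacy, with respect to the adjacency relation `adj`, of a randomized
mechanism `M` that draws its randomness from `μ`. -/
def IsDifferentiallyPrivate {𝒱 Ω 𝒪 : Type*} [MeasurableSpace Ω] [MeasurableSpace 𝒪]
    (μ : Measure Ω) (adj : 𝒱 → 𝒱 → Prop) (M : 𝒱 → Ω → 𝒪) (ε δ : ℝ) : Prop :=
  (∀ v, Measurable (M v)) ∧
  ∀ u v, adj u v → ∀ S : Set 𝒪, MeasurableSet S →
    μ {ω | M u ω ∈ S} ≤ ENNReal.ofReal (Real.exp ε) * μ {ω | M v ω ∈ S} + ENNReal.ofReal δ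

/-!
The mechanism adds Gaussian noise of standard deviation `σ = 2 Δ √(log (2 / δ)) / ε` to every entry
of `V Vᵀ`, symmetrizes, and damps the spectrum of the resulting matrix `Y = V Vᵀ + E`: an eigenvalue
`y` becomes `f y = y w / (1 + w)`, where `w = (y / l) ^ (2 q)`, `l = 128 σ √n` and `q = n + 3`. If
`σ > √n` it returns `0`, whose squared error is at most `n ^ 2 ≤ σ n ^ (3 / 2)`.

*Privacy* (`stdGaussianPi_map_add_le`). By the Cameron–Martin formula, the density between the laws
on adjacent inputs is the exponential of a linear form in the noise. It exceeds `exp ε` with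
probability at most `δ`, by a Chernoff bound. Everything after the noise is post-processing.

*Utility.* Let `X = V Vᵀ`, with trace `n`, and let `e` be the operator norm of `E`. The filter moves
eigenvalues by at most `l`, so `D = f(Y) - X` has operator norm at most `l + e`, and
`‖D‖² = tr (D f(Y)) - tr (D X)` is at most `l + e` times the sum of the nuclear norms of `f(Y)` and
`X`. In an eigenbasis of `Y` the diagonal entries of `X` are nonnegative, have sum `n`, and differ
from the eigenvalues of `Y` by at most `e`. If `e ≤ l / 4`, an eigenvalue with `|y| ≤ l / 2` is
filtered to size at most `1`, and any other one is at most twice the diagonal entry of `X`, so the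
nuclear norm of `f(Y)` is `O(n)` and the error is `O(l n) = O(σ n ^ (3 / 2))`
(`norm_sub_spectralFilter_sq_le`). The outcomes with `e > l / 4` are negligible because
`𝔼 exp (√n e / σ) ≤ exp (16 n)` (`exists_integrable_exp_norm_symmPart_le`), which follows from a
count of integer points that serve as a net of the sphere.

*Running time.* In terms of `Z = Y / l` and `B = Z ^ q`, the output is `l (Z - Z (1 + B Bᵀ)⁻¹)`, so no
eigenvalues have to be computed. The powers take `q` matrix products, and the inverse takes `n`
rank-one updates by the Sherman–Morrison formula, whose denominators are at least `1`
(`inv_add_vecMulVec_self`). All loop bounds are functions of the dimensions, and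
`Program.SizeBounded.exists_polynomial` turns this into a polynomial time bound.
-/

/-! ### Running time of programs with input-size loop bounds -/

namespace RealRAM

/-- Loop bounds that depend on the registers `0` and `1` (the dimensions of the input) only. -/
def IExp.IsSizeBound : IExp → Prop
  | lit _ => True
  | reg x => x = 0 ∨ x = 1
  | add e f => e.IsSizeBound ∧ f.IsSizeBound
  | sub e f => e.IsSizeBound ∧ f.IsSizeBound
  | mul e f => e.IsSizeBound ∧ f.IsSizeBound

/-- Programs that never write the registers `0` and `1`, and all of whose loop bounds depend on
these two registers only. -/
def Program.SizeBounded : Program → Prop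
  | skip => True
  | setIndex x _ => x ≠ 0 ∧ x ≠ 1
  | setCell _ _ _ _ => True
  | gauss _ _ _ => True
  | seq c d => c.SizeBounded ∧ d.SizeBounded
  | ifLe _ _ c d => c.SizeBounded ∧ d.SizeBounded
  | loop x e c => x ≠ 0 ∧ x ≠ 1 ∧ e.IsSizeBound ∧ c.SizeBounded

lemma IExp.IsSizeBound.exists_polynomial {e : IExp} (he : e.IsSizeBound) :
    ∃ p : Polynomial ℕ, ∀ s : State, e.eval s ≤ p.eval (s.reg 0 + s.reg 1) := by
  induction e with
  | lit k => exact ⟨Polynomial.C k, fun s => by simp [eval]⟩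
  | reg x =>
    refine ⟨Polynomial.X, fun s => ?_⟩
    rcases he with rfl | rfl <;> simp [eval]
  | add e f ihe ihf =>
    obtain ⟨p, hp⟩ := ihe he.1
    obtain ⟨q, hq⟩ := ihf he.2
    exact ⟨p + q, fun s => by simpa [eval] using add_le_add (hp s) (hq s)⟩
  | sub e f ihe ihf =>
    obtain ⟨p, hp⟩ := ihe he.1
    exact ⟨p, fun s => (Nat.sub_le _ _).trans (hp s)⟩
  | mul e f ihe ihf =>
    obtain ⟨p, hp⟩ := ihe he.1
    obtain ⟨q, hq⟩ := ihf he.2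
    exact ⟨p * q, fun s => by simpa [eval] using Nat.mul_le_mul (hp s) (hq s)⟩

/-- Invariant rule for loops. -/
lemma Program.run_loop_induction {ω : ℕ → ℝ} {x : ℕ} {e : IExp} {c : Program} {s : State}
    (I : ℕ → State → Prop) (h0 : I 0 (s.tick (e.cost + 1)))
    (hstep : ∀ k t, k < e.eval s → I k t → I (k + 1) (c.run ω ((t.setReg x k).tick 1))) :
    I (e.eval s) ((loop x e c).run ω s) := by
  rw [Program.run]
  have key : ∀ N ≤ e.eval s, I N ((List.range N).foldl
      (fun t k => c.run ω ((t.setReg x k).tick 1)) (s.tick (e.cost + 1))) := by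
    intro N
    induction N with
    | zero => intro _; simpa using h0
    | succ N ih =>
      intro hN
      rw [List.range_succ, List.foldl_append]
      exact hstep N _ (by omega) (ih (by omega))
  exact key _ le_rfl

/-- A size-bounded program runs in polynomial time. -/
theorem Program.SizeBounded.exists_polynomial {c : Program} (hc : c.SizeBounded) :
    ∃ p : Polynomial ℕ, ∀ (ω : ℕ → ℝ) (s : State),
      (c.run ω s).reg 0 = s.reg 0 ∧ (c.run ω s).reg 1 = s.reg 1 ∧
        (c.run ω s).time ≤ s.time + p.eval (s.reg 0 + s.reg 1) := by
  induction c with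
  | skip => exact ⟨1, fun ω s => by simp [run, State.tick]⟩
  | setIndex x e =>
    refine ⟨Polynomial.C (e.cost + 1), fun ω s => ?_⟩
    simp [run, State.tick, State.setReg, Function.update, hc.1.symm, hc.2.symm]
  | setCell a i j e =>
    exact ⟨Polynomial.C (i.cost + j.cost + e.cost + 1), fun ω s => by
      simp [run, State.tick, State.setMem]⟩
  | gauss a i j =>
    exact ⟨Polynomial.C (i.cost + j.cost + 1), fun ω s => by
      simp [run, State.tick, State.setMem]⟩
  | seq c d ihc ihd =>
    obtain ⟨p, hp⟩ := ihc hc.1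
    obtain ⟨q, hq⟩ := ihd hc.2
    refine ⟨p + q, fun ω s => ?_⟩
    obtain ⟨h0, h1, h2⟩ := hp ω s
    obtain ⟨h0', h1', h2'⟩ := hq ω (c.run ω s)
    rw [h0, h1] at h2'
    simp only [run, Polynomial.eval_add]
    exact ⟨h0'.trans h0, h1'.trans h1, by omega⟩
  | ifLe e f c d ihc ihd =>
    obtain ⟨p, hp⟩ := ihc hc.1
    obtain ⟨q, hq⟩ := ihd hc.2
    refine ⟨p + q + Polynomial.C (e.cost + f.cost + 1), fun ω s => ?_⟩
    obtain ⟨h0, h1, h2⟩ := hp ω (s.tick (e.cost + f.cost + 1))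
    obtain ⟨h0', h1', h2'⟩ := hq ω (s.tick (e.cost + f.cost + 1))
    simp only [State.tick] at h0 h1 h2 h0' h1' h2'
    simp only [run, Polynomial.eval_add, Polynomial.eval_C, State.tick]
    split_ifs
    · exact ⟨h0, h1, by omega⟩
    · exact ⟨h0', h1', by omega⟩
  | loop x e c ihc =>
    obtain ⟨hx0, hx1, he, hc⟩ := hc
    obtain ⟨p, hp⟩ := ihc hc
    obtain ⟨b, hb⟩ := he.exists_polynomial
    refine ⟨Polynomial.C (e.cost + 1) + b * (p + 1), fun ω s => ?_⟩
    have key := run_loop_induction (ω := ω) (x := x) (e := e) (c := c) (s := s)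
      (fun k t => t.reg 0 = s.reg 0 ∧ t.reg 1 = s.reg 1 ∧
        t.time ≤ s.time + (e.cost + 1) + k * (p.eval (s.reg 0 + s.reg 1) + 1))
      (by simp [State.tick]) ?_
    · obtain ⟨h0, h1, h2⟩ := key
      refine ⟨h0, h1, h2.trans ?_⟩
      simp only [Polynomial.eval_add, Polynomial.eval_mul, Polynomial.eval_C, Polynomial.eval_one]
      have := Nat.mul_le_mul_right (p.eval (s.reg 0 + s.reg 1) + 1) (hb s)
      omega
    · rintro k t - ⟨h0, h1, h2⟩
      obtain ⟨h0', h1', h2'⟩ := hp ω ((t.setReg x k).tick 1)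
      simp only [State.tick, State.setReg, Function.update_of_ne hx0.symm,
        Function.update_of_ne hx1.symm, h0, h1] at h0' h1' h2'
      refine ⟨h0', h1', h2'.trans ?_⟩
      rw [Nat.succ_mul]
      omega

/-! ### Filling matrices entry by entry -/

/-- Execute `c` with the registers `2` and `3` running over all pairs of indices below `n`. -/
def forEntries (c : Program) : Program :=
  .loop 2 (.reg 0) (.loop 3 (.reg 0) c)

/-- The entry of array `a` addressed by the registers `i` and `j`. -/
def entry (a i j : ℕ) : RExp := .cell a (.reg i) (.reg j)

/-- Set every entry of array `a` to the value of `e`, where the registers `2` and `3` hold the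
row and the column. -/
def fill (a : ℕ) (e : RExp) : Program :=
  forEntries (.setCell a (.reg 2) (.reg 3) e)

/-- Fill array `a` with independent standard Gaussians, row by row. -/
def fillGauss (a : ℕ) : Program :=
  forEntries (.gauss a (.reg 2) (.reg 3))

/-- Set every entry of array `a` to the sum of the values of `e`, where the registers `2` and `3`
hold the row and the column, and register `4` runs over the indices below `N`. -/
def fillSum (a : ℕ) (N : IExp) (e : RExp) : Program :=
  forEntries (.seq (.setCell a (.reg 2) (.reg 3) (.ofIndex (.lit 0)))
    (.loop 4 N (.setCell a (.reg 2) (.reg 3) (.add (entry a 2 3) e))))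

/-- The states `s` and `t` differ in array `a`, the registers `2`, `3`, `4`, the clock and the
number of draws at most. -/
structure SameOff (a : ℕ) (s t : State) : Prop where
  reg : ∀ x, x ≠ 2 → x ≠ 3 → x ≠ 4 → t.reg x = s.reg x
  mem : ∀ b, b ≠ a → t.mem b = s.mem b

lemma SameOff.trans {a : ℕ} {s t u : State} (h : SameOff a s t) (h' : SameOff a t u) :
    SameOff a s u :=
  ⟨fun x h2 h3 h4 => (h'.reg x h2 h3 h4).trans (h.reg x h2 h3 h4),
    fun b hb => (h'.mem b hb).trans (h.mem b hb)⟩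

/-- If the body `c`, run at `(i, j)`, writes `F i j` into entry `(i, j)` of array `a` and draws `g`
Gaussians, then the loop over all entries fills the upper left `n × n` block of `a` with `F`. The
hypothesis may use that `g * (i * n + j)` Gaussians have been drawn before. -/
lemma forEntries_spec {ω : ℕ → ℝ} {c : Program} {a n g : ℕ} {s : State} (hn : s.reg 0 = n)
    (F : ℕ → ℕ → ℝ)
    (hc : ∀ t i j, i < n → j < n → SameOff a s t → t.reg 2 = i → t.reg 3 = j →
      t.drawn = s.drawn + g * (i * n + j) →
      SameOff a t (c.run ω t) ∧ (c.run ω t).reg 2 = i ∧ (c.run ω t).drawn = t.drawn + g ∧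
        (∀ i' j', (c.run ω t).mem a i' j' = if i' = i ∧ j' = j then F i j else t.mem a i' j')) :
    SameOff a s ((forEntries c).run ω s) ∧
      ∀ i j, i < n → j < n → ((forEntries c).run ω s).mem a i j = F i j := by
  have key := Program.run_loop_induction (ω := ω) (x := 2) (e := .reg 0)
      (c := .loop 3 (.reg 0) c) (s := s)
    (fun k t => SameOff a s t ∧ t.drawn = s.drawn + g * (k * n) ∧
      ∀ i j, i < k → j < n → t.mem a i j = F i j)
    ⟨⟨by simp [State.tick], by simp [State.tick]⟩, by simp [State.tick], by simp⟩ ?_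
  · simp only [IExp.eval, hn] at key
    exact ⟨key.1, fun i j hi hj => key.2.2 i j hi hj⟩
  · rintro k t hk ⟨hst, hd, hF⟩
    simp only [IExp.eval, hn] at hk
    have ht0 : t.reg 0 = n := by rw [hst.reg 0 (by decide) (by decide) (by decide), hn]
    have inner := Program.run_loop_induction (ω := ω) (x := 3) (e := .reg 0)
        (c := c) (s := (t.setReg 2 k).tick 1)
      (fun l u => SameOff a s u ∧ u.reg 2 = k ∧ u.drawn = s.drawn + g * (k * n + l) ∧
        (∀ i j, i < k → j < n → u.mem a i j = F i j) ∧ ∀ j < l, u.mem a k j = F k j)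
      ⟨⟨fun x h2 h3 h4 => by
          simpa [State.tick, State.setReg, Function.update, h2] using hst.reg x h2 h3 h4,
        fun b hb => by simpa [State.tick, State.setReg] using hst.mem b hb⟩,
        by simp [State.tick, State.setReg], by simpa [State.tick, State.setReg] using hd,
        by simpa [State.tick, State.setReg] using hF, by simp⟩ ?_
    · simp only [IExp.eval, State.tick, State.setReg] at inner
      rw [Function.update_of_ne (by decide), ht0] at inner
      obtain ⟨h1, h2, h3, h4, h5⟩ := inner
      refine ⟨h1, by rw [Nat.succ_mul]; exact h3, fun i j hi hj => ?_⟩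
      rcases Nat.lt_succ_iff_lt_or_eq.1 hi with hi | rfl
      · exact h4 i j hi hj
      · exact h5 j hj
    · rintro l u hl ⟨h1, h2, h3, h4, h5⟩
      simp only [IExp.eval, State.tick, State.setReg] at hl
      rw [Function.update_of_ne (by decide), ht0] at hl
      set v := (u.setReg 3 l).tick 1 with hv
      have hsv : SameOff a s v :=
        ⟨fun x h2 h3 h4 => by
          simpa [hv, State.tick, State.setReg, Function.update, h3] using h1.reg x h2 h3 h4,
        fun b hb => by simpa [hv, State.tick, State.setReg] using h1.mem b hb⟩
      obtain ⟨c1, c2, c3, c4⟩ := hc v k l hk hl hsv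
        (by simpa [hv, State.tick, State.setReg] using h2)
        (by simp [hv, State.tick, State.setReg])
        (by simpa [hv, State.tick, State.setReg] using h3)
      have hvm : v.mem = u.mem := rfl
      have hvd : v.drawn = u.drawn := rfl
      refine ⟨hsv.trans c1, c2, by rw [c3, hvd, h3]; ring, fun i j hi hj => ?_, fun j hj => ?_⟩
      · rw [c4, if_neg (by omega), hvm, h4 i j hi hj]
      · rw [c4]
        split_ifs with h
        · rw [h.2]
        · rw [hvm, h5 j (by omega)]

lemma fill_spec {ω : ℕ → ℝ} {a n : ℕ} {e : RExp} {s : State} (hn : s.reg 0 = n)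
    (F : ℕ → ℕ → ℝ)
    (he : ∀ t i j, i < n → j < n → SameOff a s t → t.reg 2 = i → t.reg 3 = j →
      e.eval t = F i j) :
    SameOff a s ((fill a e).run ω s) ∧
      ∀ i j, i < n → j < n → ((fill a e).run ω s).mem a i j = F i j := by
  refine forEntries_spec (g := 0) hn F fun t i j hi hj hst h2 h3 _ => ?_
  refine ⟨⟨fun _ _ _ _ => rfl, fun b hb => ?_⟩, h2, rfl, fun i' j' => ?_⟩
  · funext i' j'
    simp [Program.run, State.tick, State.setMem, hb]
  · simp [Program.run, State.tick, State.setMem, IExp.eval, h2, h3, he t i j hi hj hst h2 h3]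

lemma fillGauss_spec {ω : ℕ → ℝ} {a n : ℕ} {s : State} (hn : s.reg 0 = n) (hd : s.drawn = 0) :
    SameOff a s ((fillGauss a).run ω s) ∧
      ∀ i j, i < n → j < n → ((fillGauss a).run ω s).mem a i j = ω (i * n + j) := by
  refine forEntries_spec (g := 1) hn (fun i j => ω (i * n + j)) fun t i j hi hj hst h2 h3 h4 => ?_
  refine ⟨⟨fun _ _ _ _ => rfl, fun b hb => ?_⟩, h2, rfl, fun i' j' => ?_⟩
  · funext i' j'
    simp [Program.run, State.tick, State.setMem, hb]
  · simp [Program.run, State.tick, State.setMem, IExp.eval, h2, h3, h4, hd]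

lemma fillSum_spec {ω : ℕ → ℝ} {a n m : ℕ} {N : IExp} {e : RExp} {s : State} (hn : s.reg 0 = n)
    (F : ℕ → ℕ → ℕ → ℝ)
    (hN : ∀ t, SameOff a s t → N.eval t = m)
    (he : ∀ t i j k, i < n → j < n → k < m → SameOff a s t → t.reg 2 = i → t.reg 3 = j →
      t.reg 4 = k → e.eval t = F i j k) :
    SameOff a s ((fillSum a N e).run ω s) ∧
      ∀ i j, i < n → j < n →
        ((fillSum a N e).run ω s).mem a i j = ∑ k ∈ Finset.range m, F i j k := by
  refine forEntries_spec (g := 0) hn (fun i j => ∑ k ∈ Finset.range m, F i j k)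
    fun t i j hi hj hst h2 h3 _ => ?_
  rw [Program.run]
  set u := (Program.setCell a (.reg 2) (.reg 3) (.ofIndex (.lit 0))).run ω t with hu
  have htu : SameOff a t u := by
    refine ⟨fun _ _ _ _ => rfl, fun b hb => ?_⟩
    funext i' j'
    simp [hu, Program.run, State.tick, State.setMem, hb]
  have key := Program.run_loop_induction (ω := ω) (x := 4) (e := N)
      (c := .setCell a (.reg 2) (.reg 3) (.add (entry a 2 3) e)) (s := u)
    (fun l v => SameOff a t v ∧ v.reg 2 = i ∧ v.reg 3 = j ∧ v.drawn = t.drawn ∧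
      ∀ i' j', v.mem a i' j' = if i' = i ∧ j' = j then ∑ k ∈ Finset.range l, F i j k
        else t.mem a i' j')
    ⟨⟨htu.reg, htu.mem⟩, h2, h3, rfl, fun i' j' => by
      simp [hu, Program.run, State.tick, State.setMem, IExp.eval, RExp.eval, h2, h3]⟩ ?_
  · rw [hN u (hst.trans htu)] at key
    obtain ⟨k1, k2, k3, k4, k5⟩ := key
    exact ⟨k1, k2, k4, k5⟩
  · rintro l v hl ⟨k1, k2, k3, k4, k5⟩
    rw [hN u (hst.trans htu)] at hl
    set w := (v.setReg 4 l).tick 1 with hw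
    have hw2 : w.reg 2 = i := by simpa [hw, State.tick, State.setReg] using k2
    have hw3 : w.reg 3 = j := by simpa [hw, State.tick, State.setReg] using k3
    have hwm : w.mem = v.mem := rfl
    have hsw : SameOff a t w := ⟨fun x h2 h3 h4 => by
        simpa [hw, State.tick, State.setReg, Function.update, h4] using k1.reg x h2 h3 h4, k1.mem⟩
    have hev := he w i j l hi hj hl (hst.trans hsw) hw2 hw3 (by simp [hw, State.tick, State.setReg])
    refine ⟨⟨hsw.reg, fun b hb => ?_⟩, hw2, hw3, k4, fun i' j' => ?_⟩
    · funext i' j'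
      rw [← hsw.mem b hb]
      simp [Program.run, State.tick, State.setMem, hb]
    · simp only [Program.run, State.tick, State.setMem, IExp.eval, RExp.eval, entry, hw2, hw3,
        hev, hwm, true_and, k5, Finset.sum_range_succ, and_self, if_true]
      split_ifs <;> rfl

end RealRAM

/-! ### The Gaussian mechanism -/

/-- The standard Gaussian measure on `ι → ℝ`. -/
noncomputable def stdGaussianPi (ι : Type*) [Fintype ι] : Measure (ι → ℝ) :=
  Measure.pi fun _ => gaussianReal 0 1

instance (ι : Type*) [Fintype ι] : IsProbabilityMeasure (stdGaussianPi ι) := by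
  unfold stdGaussianPi; infer_instance

lemma gaussianReal_map_add_eq_withDensity (a : ℝ) :
    (gaussianReal 0 1).map (· + a) =
      (gaussianReal 0 1).withDensity (fun x => ENNReal.ofReal (Real.exp (a * x - a ^ 2 / 2))) := by
  rw [gaussianReal_map_add_const, gaussianReal_of_var_ne_zero _ one_ne_zero,
    gaussianReal_of_var_ne_zero _ one_ne_zero, ← withDensity_mul _ (by fun_prop) (by fun_prop)]
  congr 1
  funext x
  simp only [Pi.mul_apply, gaussianPDF, gaussianPDFReal]
  rw [← ENNReal.ofReal_mul (by positivity), mul_assoc _ (Real.exp _) (Real.exp _), ← Real.exp_add]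
  congr 3
  simp
  ring

section
variable {ι : Type*} [Fintype ι]

/-- The Cameron–Martin formula in finite dimension. -/
theorem stdGaussianPi_map_add_eq_withDensity (a : ι → ℝ) :
    (stdGaussianPi ι).map (· + a) = (stdGaussianPi ι).withDensity
      (fun x => ENNReal.ofReal (Real.exp (∑ i, a i * x i - (∑ i, a i ^ 2) / 2))) := by
  have hsf : ∀ i, IsProbabilityMeasure ((gaussianReal 0 1).map (· + a i)) := fun i =>
    Measure.isProbabilityMeasure_map (by fun_prop)
  have h1 : (stdGaussianPi ι).map (· + a) =
      Measure.pi fun i => (gaussianReal 0 1).map (· + a i) := by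
    exact (measurePreserving_pi (fun _ => gaussianReal 0 1) _
      fun i => (⟨by fun_prop, rfl⟩ : MeasurePreserving (· + a i) _ _)).map_eq
  rw [h1, stdGaussianPi]
  refine Measure.pi_eq (μ := fun i => (gaussianReal 0 1).map (· + a i)) fun s hs => ?_
  have hint : ∀ i, Integrable ((s i).indicator fun x => Real.exp (a i * x - a i ^ 2 / 2))
      (gaussianReal 0 1) := fun i => by
    refine Integrable.indicator ?_ (hs i)
    simp_rw [sub_eq_add_neg, Real.exp_add]
    exact (integrable_exp_mul_gaussianReal _).mul_const _
  have hprod : ∀ x : ι → ℝ, (Set.univ.pi s).indicator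
      (fun x => Real.exp (∑ i, a i * x i - (∑ i, a i ^ 2) / 2)) x =
      ∏ i, (s i).indicator (fun x => Real.exp (a i * x - a i ^ 2 / 2)) (x i) := by
    intro x
    by_cases hx : x ∈ Set.univ.pi s
    · rw [Set.indicator_of_mem hx, Finset.sum_div, ← Finset.sum_sub_distrib, Real.exp_sum]
      refine Finset.prod_congr rfl fun i _ => ?_
      rw [Set.indicator_of_mem (hx i trivial)]
    · rw [Set.indicator_of_notMem hx]
      simp only [Set.mem_pi, Set.mem_univ, true_imp_iff, not_forall] at hx
      obtain ⟨i, hi⟩ := hx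
      exact (Finset.prod_eq_zero (Finset.mem_univ i) (Set.indicator_of_notMem hi _)).symm
  rw [withDensity_apply _ (MeasurableSet.univ_pi hs),
    ← lintegral_indicator (MeasurableSet.univ_pi hs)]
  have h2 : ∀ x : ι → ℝ, (Set.univ.pi s).indicator
      (fun x => ENNReal.ofReal (Real.exp (∑ i, a i * x i - (∑ i, a i ^ 2) / 2))) x =
      ENNReal.ofReal (∏ i, (s i).indicator (fun x => Real.exp (a i * x - a i ^ 2 / 2)) (x i)) := by
    intro x
    rw [← hprod]
    by_cases hx : x ∈ Set.univ.pi s <;> simp [hx]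
  have hnn : ∀ i y, 0 ≤ (s i).indicator (fun x => Real.exp (a i * x - a i ^ 2 / 2)) y :=
    fun i y => Set.indicator_nonneg (fun _ _ => (Real.exp_pos _).le) _
  simp_rw [h2]
  rw [← ofReal_integral_eq_lintegral_ofReal (Integrable.fintype_prod hint)
    (Filter.Eventually.of_forall fun x => Finset.prod_nonneg fun i _ => hnn i _)]
  rw [integral_fintype_prod_eq_prod,
    ENNReal.ofReal_prod_of_nonneg fun i _ => integral_nonneg (hnn i)]
  refine Finset.prod_congr rfl fun i _ => ?_
  rw [gaussianReal_map_add_eq_withDensity, withDensity_apply _ (hs i),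
    ofReal_integral_eq_lintegral_ofReal (hint i) (Filter.Eventually.of_forall (hnn i)),
    ← lintegral_indicator (hs i)]
  refine lintegral_congr fun x => ?_
  by_cases hx : x ∈ s i <;> simp [hx]

lemma lintegral_exp_stdGaussianPi (a : ι → ℝ) :
    ∫⁻ x, ENNReal.ofReal (Real.exp (∑ i, a i * x i)) ∂stdGaussianPi ι =
      ENNReal.ofReal (Real.exp ((∑ i, a i ^ 2) / 2)) := by
  have h : ((stdGaussianPi ι).map (· + a)) Set.univ = 1 := by
    rw [Measure.map_apply (by fun_prop) MeasurableSet.univ]; simp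
  rw [stdGaussianPi_map_add_eq_withDensity, withDensity_apply _ MeasurableSet.univ,
    Measure.restrict_univ] at h
  have h2 : ∀ x : ι → ℝ, ENNReal.ofReal (Real.exp (∑ i, a i * x i)) =
      ENNReal.ofReal (Real.exp ((∑ i, a i ^ 2) / 2)) *
        ENNReal.ofReal (Real.exp (∑ i, a i * x i - (∑ i, a i ^ 2) / 2)) := fun x => by
    rw [← ENNReal.ofReal_mul (by positivity), ← Real.exp_add]
    congr 2; ring
  simp_rw [h2]
  rw [lintegral_const_mul _ (by fun_prop), h, mul_one]

lemma integrable_exp_stdGaussianPi (a : ι → ℝ) :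
    Integrable (fun x => Real.exp (∑ i, a i * x i)) (stdGaussianPi ι) := by
  refine ⟨Measurable.aestronglyMeasurable (by fun_prop), ?_⟩
  rw [hasFiniteIntegral_iff_ofReal (Filter.Eventually.of_forall fun x => (Real.exp_pos _).le),
    lintegral_exp_stdGaussianPi]
  exact ENNReal.ofReal_lt_top

lemma integral_exp_stdGaussianPi (a : ι → ℝ) :
    ∫ x, Real.exp (∑ i, a i * x i) ∂stdGaussianPi ι = Real.exp ((∑ i, a i ^ 2) / 2) := by
  rw [integral_eq_lintegral_of_nonneg_ae (Filter.Eventually.of_forall fun x => (Real.exp_pos _).le)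
    (Measurable.aestronglyMeasurable (by fun_prop)), lintegral_exp_stdGaussianPi, ENNReal.toReal_ofReal (Real.exp_pos _).le]

/-- The Chernoff exponent of a Gaussian of mean `r / 2` and variance `r` at the level `ε`, for the
parameter `2 L / ε`. -/
lemma chernoff_exponent_le {ε L r : ℝ} (hε : 0 < ε) (hε1 : ε ≤ 1) (hL : 1 / 2 ≤ L)
    (h : 4 * L * r ≤ ε ^ 2) :
    (2 * L / ε) ^ 2 * r / 2 - 2 * L / ε * (ε - r / 2) ≤ -L := by
  have h1 : (2 * L / ε) ^ 2 * r ≤ L := by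
    rw [div_pow, div_mul_eq_mul_div, div_le_iff₀ (by positivity)]
    nlinarith
  have h2 : 2 * L / ε * r ≤ L := by
    rw [div_mul_eq_mul_div, div_le_iff₀ hε]
    nlinarith
  have h3 : 2 * L / ε * ε = 2 * L := by field_simp
  linarith

/-- A standard Gaussian and its translate by `a` are `(ε, δ)`-indistinguishable as soon as
`4 ‖a‖² log (2 / δ) ≤ ε²`. The density of the translate exceeds `exp ε` only where the
linear form `⟨a, ·⟩` is large, and that event has probability at most `δ` by a Chernoff bound. -/
theorem stdGaussianPi_map_add_le {ε δ : ℝ} (hε : 0 < ε) (hε1 : ε ≤ 1) (hδ : 0 < δ) (hδ1 : δ ≤ 1)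
    (a : ι → ℝ) (ha : 4 * (∑ i, a i ^ 2) * Real.log (2 / δ) ≤ ε ^ 2)
    {S : Set (ι → ℝ)} (hS : MeasurableSet S) :
    (stdGaussianPi ι).map (· + a) S ≤
      ENNReal.ofReal (Real.exp ε) * stdGaussianPi ι S + ENNReal.ofReal δ := by
  set r := ∑ i, a i ^ 2 with hr
  set L := Real.log (2 / δ) with hL
  have hL2 : 1 / 2 ≤ L := by
    have h1 : Real.log 2 ≤ L := Real.log_le_log (by norm_num) (by rw [le_div_iff₀ hδ]; linarith)
    linarith [Real.log_two_gt_d9]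
  have hL0 : 0 < L := by linarith
  set T : Set (ι → ℝ) := {x | ε < ∑ i, a i * x i - r / 2} with hT
  have hTm : MeasurableSet T := measurableSet_lt (by fun_prop) (by fun_prop)
  -- the exceptional event, by the exponential Markov inequality with exponent `2 L / ε`
  have hbad : (stdGaussianPi ι).map (· + a) T ≤ ENNReal.ofReal δ := by
    rw [Measure.map_apply (by fun_prop) hTm]
    set t := 2 * L / ε with ht
    have ht0 : 0 < t := by positivity
    have hsub : (fun x : ι → ℝ => x + a) ⁻¹' T ⊆
        {x | ENNReal.ofReal (Real.exp (t * (ε - r / 2))) ≤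
          ENNReal.ofReal (Real.exp (∑ i, (t • a) i * x i))} := by
      intro x hx
      simp only [hT, Set.mem_preimage, Set.mem_ofPred_eq, Pi.add_apply, mul_add,
        Finset.sum_add_distrib] at hx
      have h1 : ∑ i, a i * a i = r := by simp [hr, sq]
      rw [h1] at hx
      refine ENNReal.ofReal_le_ofReal (Real.exp_le_exp.2 ?_)
      have h2 : ∑ i, (t • a) i * x i = t * ∑ i, a i * x i := by
        simp [Finset.mul_sum, mul_assoc]
      rw [h2]
      exact mul_le_mul_of_nonneg_left (by linarith) ht0.le
    refine (measure_mono hsub).trans ?_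
    refine (meas_ge_le_lintegral_div
      (Measurable.aemeasurable (by fun_prop)) (ENNReal.ofReal_pos.2 (Real.exp_pos _)).ne'
      ENNReal.ofReal_ne_top).trans ?_
    rw [lintegral_exp_stdGaussianPi, ← ENNReal.ofReal_div_of_pos (Real.exp_pos _), ← Real.exp_sub]
    refine ENNReal.ofReal_le_ofReal ?_
    have h3 : ∑ i, (t • a) i ^ 2 = t ^ 2 * r := by
      simp [Finset.mul_sum, mul_pow, hr]
    calc Real.exp ((∑ i, (t • a) i ^ 2) / 2 - t * (ε - r / 2)) ≤ Real.exp (-L) := by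
          refine Real.exp_le_exp.2 ?_
          rw [h3]
          exact chernoff_exponent_le hε hε1 hL2 (by linarith)
      _ = δ / 2 := by rw [hL, Real.exp_neg, Real.exp_log (by positivity), inv_div]
      _ ≤ δ := by linarith
  have hgood : (stdGaussianPi ι).map (· + a) (S \ T) ≤
      ENNReal.ofReal (Real.exp ε) * stdGaussianPi ι S := by
    rw [stdGaussianPi_map_add_eq_withDensity, withDensity_apply _ (hS.diff hTm)]
    calc ∫⁻ x in S \ T, ENNReal.ofReal (Real.exp (∑ i, a i * x i - (∑ i, a i ^ 2) / 2))
          ∂stdGaussianPi ι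
        ≤ ∫⁻ x in S \ T, ENNReal.ofReal (Real.exp ε) ∂stdGaussianPi ι := by
          refine setLIntegral_mono (by fun_prop) fun x hx => ?_
          exact ENNReal.ofReal_le_ofReal (Real.exp_le_exp.2 (not_lt.1 hx.2))
      _ = ENNReal.ofReal (Real.exp ε) * stdGaussianPi ι (S \ T) := by
          rw [setLIntegral_const]
      _ ≤ _ := by gcongr; exact Set.sdiff_subset
  calc (stdGaussianPi ι).map (· + a) S
      ≤ (stdGaussianPi ι).map (· + a) (S \ T ∪ T) := measure_mono (by simp)
    _ ≤ _ := (measure_union_le _ _).trans (add_le_add hgood hbad)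

end

instance : IsProbabilityMeasure RealRAM.randomness := by
  unfold RealRAM.randomness; infer_instance

/-- Reading off distinct draws gives a standard Gaussian vector. -/
lemma measurePreserving_randomness {ι : Type*} [Fintype ι] {f : ι → ℕ} (hf : f.Injective) :
    MeasurePreserving (fun (ω : ℕ → ℝ) i => ω (f i)) RealRAM.randomness (stdGaussianPi ι) := by
  refine ⟨by fun_prop, ?_⟩
  have hind : iIndepFun (fun (n : ℕ) (ω : ℕ → ℝ) => ω n) RealRAM.randomness :=
    iIndepFun_infinitePi (X := fun _ x => x) (fun _ => measurable_id)
  have h := (iIndepFun_iff_map_fun_eq_pi_map (fun i => (measurable_pi_apply _).aemeasurable)).1 (hind.precomp hf)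
  rw [h, stdGaussianPi]
  congr 1
  funext i
  exact (measurePreserving_eval_infinitePi (fun _ : ℕ => gaussianReal 0 1) (f i)).map_eq

/-! ### Spectral filtering of a noisy Gram matrix -/

section LinearAlgebra
variable {n m : Type*} [Fintype n] [Fintype m]

lemma frobenius_norm_sq (A : Matrix n m ℝ) : ‖A‖ ^ 2 = ∑ i, ∑ j, A i j ^ 2 := by
  rw [Matrix.frobenius_norm_def, ← Real.sqrt_eq_rpow, Real.sq_sqrt (by positivity)]
  simp

lemma frobenius_norm_sq_eq_trace (A : Matrix n m ℝ) : ‖A‖ ^ 2 = (Aᵀ * A).trace := by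
  rw [frobenius_norm_sq, Finset.sum_comm]
  simp [Matrix.trace, Matrix.mul_apply, sq]

lemma transpose_mul_mul_apply_self {m : Type*} (B : Matrix n m ℝ) (D : Matrix n n ℝ) (j : m) :
    (Bᵀ * D * B) j j = (fun i => B i j) ⬝ᵥ D *ᵥ (fun i => B i j) := by
  simp only [Matrix.mul_apply, dotProduct, Matrix.mulVec, Matrix.transpose_apply,
    Finset.sum_mul, Finset.mul_sum]
  rw [Finset.sum_comm]
  exact Finset.sum_congr rfl fun i _ => Finset.sum_congr rfl fun k _ => by ring

variable [DecidableEq n]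

lemma exists_orthogonal_diagonalization {A : Matrix n n ℝ} (hA : Aᵀ = A) :
    ∃ (U : Matrix n n ℝ) (a : n → ℝ),
      Uᵀ * U = 1 ∧ U * Uᵀ = 1 ∧ A = U * Matrix.diagonal a * Uᵀ := by
  have hA' : A.IsHermitian := by
    rw [Matrix.IsHermitian, Matrix.conjTranspose_eq_transpose_of_trivial, hA]
  refine ⟨hA'.eigenvectorUnitary, hA'.eigenvalues, ?_, ?_, ?_⟩
  · have := Unitary.coe_star_mul_self hA'.eigenvectorUnitary
    rwa [Matrix.star_eq_conjTranspose, Matrix.conjTranspose_eq_transpose_of_trivial] at this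
  · have := Matrix.mem_unitaryGroup_iff.1 hA'.eigenvectorUnitary.2
    rwa [Matrix.star_eq_conjTranspose, Matrix.conjTranspose_eq_transpose_of_trivial] at this
  · have := hA'.spectral_theorem
    rwa [Unitary.conjStarAlgAut_apply, Matrix.star_eq_conjTranspose,
      Matrix.conjTranspose_eq_transpose_of_trivial] at this

variable {U : Matrix n n ℝ} {a : n → ℝ}

lemma dotProduct_mulVec_conj_diagonal (v : n → ℝ) :
    v ⬝ᵥ (U * Matrix.diagonal a * Uᵀ) *ᵥ v = ∑ i, a i * (Uᵀ *ᵥ v) i ^ 2 := by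
  rw [← Matrix.mulVec_mulVec, ← Matrix.mulVec_mulVec, Matrix.dotProduct_mulVec,
    ← Matrix.mulVec_transpose]
  simp only [dotProduct, Matrix.mulVec_diagonal]
  exact Finset.sum_congr rfl fun i _ => by ring

lemma sum_sq_transpose_mulVec (hU : U * Uᵀ = 1) (v : n → ℝ) :
    ∑ i, (Uᵀ *ᵥ v) i ^ 2 = ∑ i, v i ^ 2 := by
  have h := dotProduct_mulVec_conj_diagonal (U := U) (a := fun _ => 1) v
  rw [Matrix.diagonal_one, Matrix.mul_one, hU, Matrix.one_mulVec] at h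
  simpa [dotProduct, sq] using h.symm

lemma abs_dotProduct_mulVec_conj_diagonal_le (hU : U * Uᵀ = 1) {c : ℝ} (ha : ∀ i, |a i| ≤ c)
    (v : n → ℝ) : |v ⬝ᵥ (U * Matrix.diagonal a * Uᵀ) *ᵥ v| ≤ c * ∑ i, v i ^ 2 := by
  rw [dotProduct_mulVec_conj_diagonal, ← sum_sq_transpose_mulVec hU v, Finset.mul_sum]
  refine (Finset.abs_sum_le_sum_abs _ _).trans (Finset.sum_le_sum fun i _ => ?_)
  rw [abs_mul, abs_of_nonneg (sq_nonneg ((Uᵀ *ᵥ v) i))]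
  exact mul_le_mul_of_nonneg_right (ha i) (sq_nonneg _)

lemma sum_sq_column (hU : Uᵀ * U = 1) (i : n) : ∑ k, U k i ^ 2 = 1 := by
  have h := congrFun (congrFun hU i) i
  simpa [Matrix.mul_apply, sq] using h

/-- The spectral filter with gain `z ^ (2 q) / (1 + z ^ (2 q))` at the eigenvalue `z`. For large
`q` it removes the eigenvalues in `(-1, 1)` and keeps the others. -/
noncomputable def spectralFilter (q : ℕ) (Z : Matrix n n ℝ) : Matrix n n ℝ :=
  Z - Z * (1 + Z ^ q * Z ^ q)⁻¹

/-- The spectral filter on eigenvalues. -/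
noncomputable def scalarFilter (q : ℕ) (z : ℝ) : ℝ :=
  z - z * (1 + z ^ q * z ^ q)⁻¹

lemma conj_diagonal_mul (hU : Uᵀ * U = 1) (a b : n → ℝ) :
    U * Matrix.diagonal a * Uᵀ * (U * Matrix.diagonal b * Uᵀ) =
      U * Matrix.diagonal (fun i => a i * b i) * Uᵀ := by
  rw [← Matrix.diagonal_mul_diagonal]
  calc U * Matrix.diagonal a * Uᵀ * (U * Matrix.diagonal b * Uᵀ)
      = U * Matrix.diagonal a * (Uᵀ * U) * Matrix.diagonal b * Uᵀ := by noncomm_ring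
    _ = _ := by rw [hU]; noncomm_ring

lemma conj_diagonal_pow (hU : Uᵀ * U = 1) (hU' : U * Uᵀ = 1) (a : n → ℝ) (q : ℕ) :
    (U * Matrix.diagonal a * Uᵀ) ^ q = U * Matrix.diagonal (fun i => a i ^ q) * Uᵀ := by
  induction q with
  | zero => simp [hU']
  | succ q ih => simp_rw [pow_succ, ih, conj_diagonal_mul hU]

lemma spectralFilter_conj_diagonal (hU : Uᵀ * U = 1) (hU' : U * Uᵀ = 1) (a : n → ℝ) (q : ℕ) :
    spectralFilter q (U * Matrix.diagonal a * Uᵀ) =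
      U * Matrix.diagonal (fun i => scalarFilter q (a i)) * Uᵀ := by
  have h1 : (1 : Matrix n n ℝ) = U * Matrix.diagonal (fun _ => 1) * Uᵀ := by
    rw [Matrix.diagonal_one, Matrix.mul_one, hU']
  have h2 : (1 + (U * Matrix.diagonal a * Uᵀ) ^ q * (U * Matrix.diagonal a * Uᵀ) ^ q)⁻¹ =
      U * Matrix.diagonal (fun i => (1 + a i ^ q * a i ^ q)⁻¹) * Uᵀ := by
    refine Matrix.inv_eq_right_inv ?_
    rw [conj_diagonal_pow hU hU', conj_diagonal_mul hU]
    nth_rewrite 1 [h1]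
    rw [← Matrix.add_mul, ← Matrix.mul_add, Matrix.diagonal_add, conj_diagonal_mul hU]
    have h3 : ∀ i, (1 + a i ^ q * a i ^ q) * (1 + a i ^ q * a i ^ q)⁻¹ = 1 := fun i =>
      mul_inv_cancel₀ (by linarith [mul_self_nonneg (a i ^ q)] : 0 < 1 + a i ^ q * a i ^ q).ne'
    simp [h3, hU']
  rw [spectralFilter, h2, conj_diagonal_mul hU, ← Matrix.sub_mul, ← Matrix.mul_sub,
    Matrix.diagonal_sub]
  rfl


lemma abs_scalarFilter_le (q : ℕ) (z : ℝ) : |scalarFilter q z| ≤ |z| := by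
  have h1 : (1 : ℝ) ≤ 1 + z ^ q * z ^ q := by nlinarith [mul_self_nonneg (z ^ q)]
  have h2 := inv_le_one_of_one_le₀ h1
  have h3 : 0 ≤ (1 + z ^ q * z ^ q)⁻¹ := inv_nonneg.2 (by linarith)
  rw [scalarFilter, show z - z * (1 + z ^ q * z ^ q)⁻¹ = z * (1 - (1 + z ^ q * z ^ q)⁻¹) by ring,
    abs_mul]
  exact mul_le_of_le_one_right (abs_nonneg _) (abs_le.2 ⟨by linarith, by linarith⟩)

lemma abs_scalarFilter_sub_le {q : ℕ} (hq : q ≠ 0) (z : ℝ) : |scalarFilter q z - z| ≤ 1 := by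
  have h1 : (0 : ℝ) < 1 + z ^ q * z ^ q := by nlinarith [mul_self_nonneg (z ^ q)]
  rw [scalarFilter, sub_sub_cancel_left, abs_neg, ← div_eq_mul_inv, abs_div, abs_of_pos h1,
    div_le_one h1]
  have h2 : z ^ q * z ^ q = |z| ^ (q + q) := by rw [← pow_add, Even.pow_abs ⟨q, rfl⟩]
  rw [h2]
  rcases le_or_gt |z| 1 with h | h
  · linarith [pow_nonneg (abs_nonneg z) (q + q)]
  · linarith [le_self_pow₀ h.le (by omega : q + q ≠ 0)]

lemma abs_scalarFilter_le_of_abs_le_half (q : ℕ) {z : ℝ} (hz : |z| ≤ 1 / 2) :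
    |scalarFilter q z| ≤ 1 / 2 * (1 / 4) ^ q := by
  have h1 : (1 : ℝ) ≤ 1 + z ^ q * z ^ q := by nlinarith [mul_self_nonneg (z ^ q)]
  have h2 : z ^ q * z ^ q = (|z| ^ 2) ^ q := by
    rw [← pow_mul, ← pow_add, ← two_mul, Even.pow_abs ⟨q, by ring⟩]
  have h3 : scalarFilter q z = z * (z ^ q * z ^ q) / (1 + z ^ q * z ^ q) := by
    rw [scalarFilter]; field_simp; ring
  rw [h3, abs_div, abs_of_pos (by linarith : 0 < 1 + z ^ q * z ^ q), abs_mul,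
    abs_of_nonneg (mul_self_nonneg (z ^ q))]
  refine (div_le_self (mul_nonneg (abs_nonneg _) (mul_self_nonneg _)) h1).trans ?_
  rw [h2]
  have h4 : |z| ^ 2 ≤ 1 / 4 := by nlinarith [abs_nonneg z]
  gcongr

variable {V : Matrix n m ℝ} {E : Matrix n n ℝ} {e l : ℝ} {q : ℕ}

/-- The filtered matrix `F`, at scale `l`, of a perturbation `Y = V Vᵀ + E` of the Gram matrix of
unit vectors has `‖F - Y‖ ≤ l`, so the quadratic form of `F - V Vᵀ` is bounded by `l + e`. Pairing
this with the nuclear norms of `F` and `V Vᵀ` bounds the Frobenius error. The nuclear norm of `F`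
is bounded through `ht`: every filtered eigenvalue of `Y` is at most `α x + β`, where `x` is the
corresponding diagonal entry of `V Vᵀ` in an eigenbasis of `Y`. -/
theorem norm_sub_spectralFilter_sq_le (hV : ∀ i, ∑ j, V i j ^ 2 = 1) (hE : Eᵀ = E)
    (he : ∀ v : n → ℝ, |v ⬝ᵥ E *ᵥ v| ≤ e * ∑ i, v i ^ 2) (he0 : 0 ≤ e) (hl : 0 < l) (hq : q ≠ 0)
    {α β : ℝ}
    (ht : ∀ x y : ℝ, 0 ≤ x → |y - x| ≤ e → |l * scalarFilter q (l⁻¹ * y)| ≤ α * x + β) :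
    ‖V * Vᵀ - l • spectralFilter q (l⁻¹ • (V * Vᵀ + E))‖ ^ 2 ≤
      (l + e) * ((α + 1 + β) * Fintype.card n) := by
  set X := V * Vᵀ with hX
  have hXt : Xᵀ = X := by rw [hX, Matrix.transpose_mul, Matrix.transpose_transpose]
  obtain ⟨U, y, hU, hU', hY⟩ := exists_orthogonal_diagonalization
    (A := X + E) (by rw [Matrix.transpose_add, hXt, hE])
  set f : n → ℝ := fun i => l * scalarFilter q (l⁻¹ * y i) with hf
  have hF : l • spectralFilter q (l⁻¹ • (X + E)) = U * Matrix.diagonal f * Uᵀ := by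
    have h1 : l⁻¹ • (U * Matrix.diagonal y * Uᵀ) =
        U * Matrix.diagonal (fun i => l⁻¹ * y i) * Uᵀ := by
      rw [← Matrix.smul_mul, ← Matrix.mul_smul, ← Matrix.diagonal_smul]; rfl
    rw [hY, h1, spectralFilter_conj_diagonal hU hU', ← Matrix.smul_mul, ← Matrix.mul_smul,
      ← Matrix.diagonal_smul]
    rfl
  rw [hF, norm_sub_rev]
  set F := U * Matrix.diagonal f * Uᵀ with hFdef
  set D := F - X with hD
  have hFt : Fᵀ = F := by
    simp [hFdef, Matrix.transpose_mul, Matrix.mul_assoc]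
  have hDt : Dᵀ = D := by rw [hD, Matrix.transpose_sub, hFt, hXt]
  have hquad : ∀ v : n → ℝ, |v ⬝ᵥ D *ᵥ v| ≤ (l + e) * ∑ i, v i ^ 2 := by
    intro v
    have h1 : D = U * Matrix.diagonal (fun i => f i - y i) * Uᵀ + E := by
      have h2 : U * Matrix.diagonal (fun i => f i - y i) * Uᵀ = F - (X + E) := by
        rw [hY, hFdef, ← Matrix.sub_mul, ← Matrix.mul_sub, Matrix.diagonal_sub]
      rw [h2, hD]; abel
    rw [h1, Matrix.add_mulVec, dotProduct_add, add_mul]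
    refine (abs_add_le _ _).trans (add_le_add ?_ (he v))
    refine abs_dotProduct_mulVec_conj_diagonal_le hU' (fun i => ?_) v
    have h2 : f i - y i = l * (scalarFilter q (l⁻¹ * y i) - l⁻¹ * y i) := by
      rw [hf]; field_simp
    rw [h2, abs_mul, abs_of_pos hl]
    exact mul_le_of_le_one_right hl.le (abs_scalarFilter_sub_le hq _)
  have htr : (X.trace : ℝ) = Fintype.card n := by
    simp only [hX, Matrix.trace, Matrix.diag_apply, Matrix.mul_apply, Matrix.transpose_apply]
    simp_rw [← sq, hV]
    simp
  -- the diagonal of the Gram matrix in the eigenbasis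
  set x : n → ℝ := fun i => (Uᵀ * X * U) i i with hx
  have hx0 : ∀ i, 0 ≤ x i := by
    intro i
    have h1 : Uᵀ * X * U = (Vᵀ * U)ᵀ * (Vᵀ * U) := by
      rw [hX, Matrix.transpose_mul, Matrix.transpose_transpose]; simp only [Matrix.mul_assoc]
    simp only [hx, h1, Matrix.mul_apply (M := (Vᵀ * U)ᵀ), Matrix.transpose_apply]
    exact Finset.sum_nonneg fun k _ => mul_self_nonneg _
  have hxsum : ∑ i, x i = Fintype.card n := by
    rw [← htr]
    change (Uᵀ * X * U).trace = _
    rw [Matrix.mul_assoc, Matrix.trace_mul_comm, Matrix.mul_assoc, hU', Matrix.mul_one]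
  have hxy : ∀ i, |y i - x i| ≤ e := by
    intro i
    have h1 : Uᵀ * E * U = Matrix.diagonal y - Uᵀ * X * U := by
      have h2 : Uᵀ * (X + E) * U = Matrix.diagonal y := by
        rw [hY]
        calc Uᵀ * (U * Matrix.diagonal y * Uᵀ) * U = (Uᵀ * U) * Matrix.diagonal y * (Uᵀ * U) := by
              noncomm_ring
          _ = _ := by rw [hU]; simp
      rw [← h2]; noncomm_ring
    have h2 : y i - x i = (Uᵀ * E * U) i i := by rw [h1]; simp [hx]
    rw [h2, transpose_mul_mul_apply_self]
    simpa [sum_sq_column hU] using he fun k => U k i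
  have hfsum : ∑ i, |f i| ≤ (α + β) * Fintype.card n := by
    calc ∑ i, |f i| ≤ ∑ i, (α * x i + β) :=
          Finset.sum_le_sum fun i _ => ht (x i) (y i) (hx0 i) (hxy i)
      _ = (α + β) * Fintype.card n := by
          rw [Finset.sum_add_distrib, ← Finset.mul_sum, hxsum]; simp; ring
  have hle : 0 ≤ l + e := by positivity
  have h1 : (D * F).trace ≤ (l + e) * ∑ i, |f i| := by
    have h2 : (D * F).trace = ∑ i, (Uᵀ * D * U) i i * f i := by
      have h3 : (D * F).trace = (Uᵀ * D * U * Matrix.diagonal f).trace := by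
        rw [hFdef, ← Matrix.mul_assoc, Matrix.trace_mul_comm]
        simp only [Matrix.mul_assoc]
      rw [h3]
      simp [Matrix.trace, Matrix.mul_diagonal]
    rw [h2, Finset.mul_sum]
    refine Finset.sum_le_sum fun i _ => (le_abs_self _).trans ?_
    rw [abs_mul, transpose_mul_mul_apply_self]
    refine mul_le_mul_of_nonneg_right ?_ (abs_nonneg _)
    simpa [sum_sq_column hU] using hquad fun k => U k i
  have h2 : -(D * X).trace ≤ (l + e) * Fintype.card n := by
    have h3 : (D * X).trace = ∑ j, (Vᵀ * D * V) j j := by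
      rw [hX, ← Matrix.mul_assoc, Matrix.trace_mul_comm, ← Matrix.mul_assoc]; rfl
    rw [h3, ← htr, hX, Matrix.trace_mul_comm, Matrix.trace, Finset.mul_sum,
      ← Finset.sum_neg_distrib]
    refine Finset.sum_le_sum fun j _ => (neg_le_abs _).trans ?_
    rw [transpose_mul_mul_apply_self]
    refine (hquad _).trans_eq ?_
    simp [Matrix.mul_apply, sq]
  calc ‖D‖ ^ 2 = (D * F).trace + -(D * X).trace := by
        rw [frobenius_norm_sq_eq_trace, hDt, ← sub_eq_add_neg, ← Matrix.trace_sub,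
          ← Matrix.mul_sub]
    _ ≤ (l + e) * ((α + β) * Fintype.card n) + (l + e) * Fintype.card n :=
        add_le_add (h1.trans (mul_le_mul_of_nonneg_left hfsum hle)) h2
    _ = _ := by ring

/-- The error of the spectral filter when its scale dominates the noise. -/
theorem norm_sub_spectralFilter_sq_le_of_le (hV : ∀ i, ∑ j, V i j ^ 2 = 1) (hE : Eᵀ = E)
    (he : ∀ v : n → ℝ, |v ⬝ᵥ E *ᵥ v| ≤ e * ∑ i, v i ^ 2) (he0 : 0 ≤ e) (hl : 0 < l) (hq : q ≠ 0)
    (hel : e ≤ l / 4) (hlq : l ≤ 2 * 4 ^ q) :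
    ‖V * Vᵀ - l • spectralFilter q (l⁻¹ • (V * Vᵀ + E))‖ ^ 2 ≤ 5 * l * Fintype.card n := by
  have key := norm_sub_spectralFilter_sq_le (l := l) (q := q) (α := 2) (β := 1) hV hE he he0 hl hq ?_
  · refine key.trans ?_
    have : (0 : ℝ) ≤ Fintype.card n := by positivity
    nlinarith
  · intro x y hx hxy
    have hy := abs_le.1 hxy
    rw [abs_mul, abs_of_pos hl]
    rcases le_or_gt |y| (l / 2) with h | h
    · have h1 : |l⁻¹ * y| ≤ 1 / 2 := by
        rw [abs_mul, abs_of_pos (inv_pos.2 hl), inv_mul_le_iff₀ hl]; linarith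
      have h2 := abs_scalarFilter_le_of_abs_le_half q h1
      have h3 : l * (1 / 2 * (1 / 4) ^ q) ≤ 1 := by
        rw [div_pow, one_pow, ← mul_div_assoc, ← mul_div_assoc, div_le_one (by positivity)]
        linarith
      nlinarith [mul_le_mul_of_nonneg_left h2 hl.le]
    · have h1 := abs_scalarFilter_le q (l⁻¹ * y)
      rw [abs_mul l⁻¹, abs_of_pos (inv_pos.2 hl)] at h1
      have h2 : l * (l⁻¹ * |y|) = |y| := by field_simp
      have h3 := mul_le_mul_of_nonneg_left h1 hl.le
      rw [h2] at h3
      rcases abs_cases y with ⟨h4, _⟩ | ⟨h4, _⟩ <;> linarith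

/-- The error of the spectral filter for noise of arbitrary size. -/
theorem norm_sub_spectralFilter_sq_le_of_noise (hV : ∀ i, ∑ j, V i j ^ 2 = 1) (hE : Eᵀ = E)
    (he : ∀ v : n → ℝ, |v ⬝ᵥ E *ᵥ v| ≤ e * ∑ i, v i ^ 2) (he0 : 0 ≤ e) (hl : 0 < l)
    (hq : q ≠ 0) :
    ‖V * Vᵀ - l • spectralFilter q (l⁻¹ • (V * Vᵀ + E))‖ ^ 2 ≤
      (l + e) * ((2 + e) * Fintype.card n) := by
  have key := norm_sub_spectralFilter_sq_le (l := l) (q := q) (α := 1) (β := e) hV hE he he0 hl hq ?_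
  · refine key.trans_eq ?_
    ring
  · intro x y hx hxy
    have h1 := abs_scalarFilter_le q (l⁻¹ * y)
    rw [abs_mul l⁻¹, abs_of_pos (inv_pos.2 hl)] at h1
    have h2 : l * (l⁻¹ * |y|) = |y| := by field_simp
    have h3 := mul_le_mul_of_nonneg_left h1 hl.le
    rw [h2] at h3
    rw [abs_mul, abs_of_pos hl]
    have h4 : |y| ≤ |y - x| + |x| := by simpa using abs_add_le (y - x) x
    rw [abs_of_nonneg hx] at h4
    linarith

end LinearAlgebra

/-! ### Exponential moments of the norm of a Gaussian matrix -/

lemma sum_exp_neg_sq_le (B : ℕ) :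
    ∑ k ∈ Finset.Icc (-(B : ℤ)) B, Real.exp (-(k : ℝ) ^ 2) ≤ 3 := by
  have h1 : ∀ k : ℤ, Real.exp (-(k : ℝ) ^ 2) ≤ (1 / 2) ^ k.natAbs := by
    intro k
    have h2 : Real.exp (-1) ≤ 1 / 2 := by
      rw [Real.exp_neg, inv_eq_one_div]
      exact one_div_le_one_div_of_le (by norm_num) (by linarith [Real.add_one_le_exp (1 : ℝ)])
    calc Real.exp (-(k : ℝ) ^ 2) ≤ Real.exp (k.natAbs * (-1)) := by
          refine Real.exp_le_exp.2 ?_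
          have h3 : (k : ℝ) ^ 2 = (k.natAbs : ℝ) ^ 2 := by
            rw [Nat.cast_natAbs, Int.cast_abs, sq_abs]
          have h4 : (k.natAbs : ℝ) ≤ (k.natAbs : ℝ) ^ 2 := by
            exact_mod_cast Nat.le_self_pow two_ne_zero _
          linarith
      _ = Real.exp (-1) ^ k.natAbs := by rw [Real.exp_nat_mul]
      _ ≤ _ := by gcongr
  have h2 : ∀ B : ℕ, ∑ k ∈ Finset.Icc (-(B : ℤ)) B, (1 / 2 : ℝ) ^ k.natAbs =
      3 - 2 * (1 / 2) ^ B := by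
    intro B
    induction B with
    | zero => norm_num
    | succ B ih =>
      have h3 : Finset.Icc (-((B + 1 : ℕ) : ℤ)) (B + 1 : ℕ) =
          insert (-((B + 1 : ℕ) : ℤ)) (insert ((B + 1 : ℕ) : ℤ) (Finset.Icc (-(B : ℤ)) B)) := by
        ext k
        simp only [Finset.mem_Icc, Finset.mem_insert]
        omega
      rw [h3, Finset.sum_insert (by simp; omega), Finset.sum_insert (by simp), ih, Int.natAbs_neg,
        Int.natAbs_natCast, pow_succ]
      ring
  calc _ ≤ ∑ k ∈ Finset.Icc (-(B : ℤ)) B, (1 / 2 : ℝ) ^ k.natAbs :=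
        Finset.sum_le_sum fun k _ => h1 k
    _ ≤ 3 := by rw [h2]; linarith [pow_pos (by norm_num : (0 : ℝ) < 1 / 2) B]

/-- The integer points of `ℤⁿ` in the Euclidean ball of radius `(5 / 2) √n`. After scaling by
`1 / (2 √n)`, they come within distance `1 / 4` of every unit vector. -/
noncomputable def gridNet (n : ℕ) : Finset (Fin n → ℤ) :=
  (Fintype.piFinset fun _ => Finset.Icc (-((3 * n : ℕ) : ℤ)) (3 * n : ℕ)).filter
    fun z => ∑ i, (z i : ℝ) ^ 2 ≤ 25 / 4 * n

lemma mem_gridNet {n : ℕ} {z : Fin n → ℤ} :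
    z ∈ gridNet n ↔ ∑ i, (z i : ℝ) ^ 2 ≤ 25 / 4 * n := by
  rw [gridNet, Finset.mem_filter, and_iff_right_iff_imp]
  intro h
  refine Fintype.mem_piFinset.2 fun i => ?_
  have h1 : (z i : ℝ) ^ 2 ≤ 25 / 4 * n :=
    (Finset.single_le_sum (f := fun i => (z i : ℝ) ^ 2) (fun _ _ => sq_nonneg _)
      (Finset.mem_univ i)).trans h
  have hn : (1 : ℝ) ≤ n := by exact_mod_cast i.pos
  have h2 : |(z i : ℝ)| ≤ 3 * n := abs_le_of_sq_le_sq (by nlinarith) (by positivity)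
  rw [Finset.mem_Icc, ← abs_le]
  exact_mod_cast h2

lemma card_gridNet_le (n : ℕ) : ((gridNet n).card : ℝ) ≤ Real.exp (25 / 4 * n) * 3 ^ n := by
  calc ((gridNet n).card : ℝ) = ∑ z ∈ gridNet n, 1 := by simp
    _ ≤ ∑ z ∈ gridNet n, Real.exp (25 / 4 * n) * ∏ i, Real.exp (-(z i : ℝ) ^ 2) := by
        refine Finset.sum_le_sum fun z hz => ?_
        rw [← Real.exp_sum, ← Real.exp_add, Finset.sum_neg_distrib]
        exact Real.one_le_exp (by linarith [mem_gridNet.1 hz])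
    _ ≤ ∑ z ∈ Fintype.piFinset fun _ : Fin n => Finset.Icc (-((3 * n : ℕ) : ℤ)) (3 * n : ℕ),
          Real.exp (25 / 4 * n) * ∏ i, Real.exp (-(z i : ℝ) ^ 2) :=
        Finset.sum_le_sum_of_subset_of_nonneg (Finset.filter_subset _ _)
          fun _ _ _ => by positivity
    _ = Real.exp (25 / 4 * n) * ∏ _i : Fin n,
          ∑ k ∈ Finset.Icc (-((3 * n : ℕ) : ℤ)) (3 * n : ℕ), Real.exp (-(k : ℝ) ^ 2) := by
        rw [← Finset.mul_sum, Finset.prod_univ_sum]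
    _ ≤ Real.exp (25 / 4 * n) * ∏ _i : Fin n, (3 : ℝ) := by
        gcongr with i
        exact sum_exp_neg_sq_le _
    _ = _ := by simp

/-- Some point of the net captures a fixed proportion of the norm of a symmetric matrix: round
`2 √n x`, where `x` is a unit eigenvector whose eigenvalue has maximal modulus. -/
lemma exists_mem_gridNet {n : ℕ} (hn : 0 < n) {T : Matrix (Fin n) (Fin n) ℝ} (hT : Tᵀ = T) :
    ∃ s : ℝ, 0 ≤ s ∧ (∀ v : Fin n → ℝ, |v ⬝ᵥ T *ᵥ v| ≤ s * ∑ i, v i ^ 2) ∧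
      ∃ z ∈ gridNet n, 7 / 4 * n * s ≤ |(fun i => (z i : ℝ)) ⬝ᵥ T *ᵥ (fun i => (z i : ℝ))| := by
  obtain ⟨U, a, hU, hU', rfl⟩ := exists_orthogonal_diagonalization hT
  have : Nonempty (Fin n) := ⟨⟨0, hn⟩⟩
  obtain ⟨i₀, hi₀⟩ := Finite.exists_max fun i => |a i|
  refine ⟨|a i₀|, abs_nonneg _, abs_dotProduct_mulVec_conj_diagonal_le hU' hi₀, ?_⟩
  set N : ℝ := 2 * √n with hN
  have hN0 : 0 ≤ N := by positivity
  have hN2 : N ^ 2 = 4 * n := by rw [hN, mul_pow, Real.sq_sqrt (by positivity)]; norm_num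
  set z : Fin n → ℤ := fun i => round (N * U i i₀) with hz
  set d : Fin n → ℝ := fun i => z i - N * U i i₀ with hd
  have hzd : ∀ i, (z i : ℝ) = N * U i i₀ + d i := fun i => by simp [hd]
  have hx : ∑ i, U i i₀ ^ 2 = 1 := sum_sq_column hU i₀
  have hd2 : ∑ i, d i ^ 2 ≤ n / 4 := by
    calc ∑ i, d i ^ 2 ≤ ∑ _i : Fin n, (1 / 4 : ℝ) := by
          refine Finset.sum_le_sum fun i _ => ?_
          have h1 : |d i| ≤ 1 / 2 := by
            rw [hd, abs_sub_comm]; exact abs_sub_round _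
          rw [← sq_abs]
          nlinarith [abs_nonneg (d i)]
      _ = n / 4 := by simp; ring
  set p := ∑ i, U i i₀ * d i with hp
  have hp2 : p ^ 2 ≤ n / 4 := by
    have := Finset.sum_mul_sq_le_sq_mul_sq Finset.univ (fun i => U i i₀) d
    rw [hx, one_mul] at this
    exact this.trans hd2
  have hNp : |2 * N * p| ≤ 2 * n := by
    refine abs_le_of_sq_le_sq ?_ (by positivity)
    rw [mul_pow, mul_pow, hN2]
    nlinarith [(by exact_mod_cast hn : (0 : ℝ) < n)]
  have hNp' := abs_le.1 hNp
  have hzsum : ∑ i, (z i : ℝ) ^ 2 = N ^ 2 + 2 * N * p + ∑ i, d i ^ 2 := by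
    simp_rw [hzd, add_sq, mul_pow]
    rw [Finset.sum_add_distrib, Finset.sum_add_distrib, ← Finset.mul_sum, hx, hp, Finset.mul_sum,
      mul_one]
    congr 2
    exact Finset.sum_congr rfl fun i _ => by ring
  refine ⟨z, mem_gridNet.2 (by rw [hzsum, hN2]; linarith), ?_⟩
  rw [dotProduct_mulVec_conj_diagonal]
  set c := Uᵀ *ᵥ (fun i => (z i : ℝ)) with hc
  have hc0 : c i₀ = N + p := by
    simp only [hc, Matrix.mulVec, dotProduct, Matrix.transpose_apply, hzd, mul_add,
      Finset.sum_add_distrib, hp]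
    congr 1
    calc ∑ i, U i i₀ * (N * U i i₀) = N * ∑ i, U i i₀ ^ 2 := by
          rw [Finset.mul_sum]; exact Finset.sum_congr rfl fun i _ => by ring
      _ = N := by rw [hx, mul_one]
  have hcsum : ∑ i, c i ^ 2 = ∑ i, (z i : ℝ) ^ 2 := sum_sq_transpose_mulVec hU' _
  rw [← Finset.add_sum_erase _ _ (Finset.mem_univ i₀)] at hcsum ⊢
  have hrest : |∑ i ∈ Finset.univ.erase i₀, a i * c i ^ 2| ≤
      |a i₀| * ∑ i ∈ Finset.univ.erase i₀, c i ^ 2 := by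
    rw [Finset.mul_sum]
    refine (Finset.abs_sum_le_sum_abs _ _).trans (Finset.sum_le_sum fun i _ => ?_)
    rw [abs_mul, abs_of_nonneg (sq_nonneg (c i))]
    exact mul_le_mul_of_nonneg_right (hi₀ i) (sq_nonneg _)
  have h1 : |a i₀ * c i₀ ^ 2| = |a i₀| * c i₀ ^ 2 := by
    rw [abs_mul, abs_of_nonneg (sq_nonneg (c i₀))]
  have h2 := abs_sub_abs_le_abs_sub (a i₀ * c i₀ ^ 2)
    (-∑ i ∈ Finset.univ.erase i₀, a i * c i ^ 2)
  rw [abs_neg, sub_neg_eq_add, h1] at h2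
  have h3 : 7 / 4 * n ≤ c i₀ ^ 2 - ∑ i ∈ Finset.univ.erase i₀, c i ^ 2 := by
    have h4 : ∑ i ∈ Finset.univ.erase i₀, c i ^ 2 = ∑ i, (z i : ℝ) ^ 2 - c i₀ ^ 2 := by linarith
    rw [h4, hc0, hzsum]
    nlinarith [sq_nonneg p]
  have h5 := mul_le_mul_of_nonneg_left h3 (abs_nonneg (a i₀))
  linarith

/-- The symmetric part of a square matrix. -/
noncomputable def symmPart {n : ℕ} (W : Matrix (Fin n) (Fin n) ℝ) : Matrix (Fin n) (Fin n) ℝ :=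
  (2⁻¹ : ℝ) • (W + Wᵀ)

lemma transpose_symmPart {n : ℕ} (W : Matrix (Fin n) (Fin n) ℝ) : (symmPart W)ᵀ = symmPart W := by
  simp [symmPart, add_comm]

lemma dotProduct_symmPart_mulVec {n : ℕ} (W : Matrix (Fin n) (Fin n) ℝ) (v : Fin n → ℝ) :
    v ⬝ᵥ symmPart W *ᵥ v = v ⬝ᵥ W *ᵥ v := by
  have h : v ⬝ᵥ Wᵀ *ᵥ v = v ⬝ᵥ W *ᵥ v := by
    rw [Matrix.mulVec_transpose, dotProduct_comm, ← Matrix.dotProduct_mulVec]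
  rw [symmPart, Matrix.smul_mulVec, Matrix.add_mulVec, dotProduct_smul, dotProduct_add, h,
    smul_eq_mul]
  ring

/-- The norm `s` of the symmetric part of a Gaussian matrix satisfies
`𝔼 exp (√n s) ≤ exp (16 n)`. The integrand is replaced by a sum over the net, which is a finite
sum of exponentials of linear forms in the Gaussian entries. -/
theorem exists_integrable_exp_norm_symmPart_le {n : ℕ} (hn : 0 < n) :
    ∃ Φ : (Fin n × Fin n → ℝ) → ℝ, Integrable Φ (stdGaussianPi (Fin n × Fin n)) ∧
      ∫ g, Φ g ∂stdGaussianPi (Fin n × Fin n) ≤ Real.exp (16 * n) ∧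
      ∀ g, ∃ s : ℝ, 0 ≤ s ∧ Real.exp (√n * s) ≤ Φ g ∧
        ∀ v : Fin n → ℝ, |v ⬝ᵥ symmPart (Matrix.of fun i j => g (i, j)) *ᵥ v| ≤
          s * ∑ i, v i ^ 2 := by
  have hn' : (0 : ℝ) < n := by exact_mod_cast hn
  have hsn : 0 < √(n : ℝ) := Real.sqrt_pos.2 hn'
  have hsn2 : √(n : ℝ) ^ 2 = n := Real.sq_sqrt hn'.le
  -- this value makes `θ * (7 / 4 * n) = √n`
  set θ : ℝ := 4 / (7 * √n) with hθ
  set b : ℝ → (Fin n → ℤ) → Fin n × Fin n → ℝ := fun t z p => t * (z p.1 * z p.2) with hb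
  have hbsum : ∀ t z, ∑ p, b t z p ^ 2 = t ^ 2 * (∑ i, (z i : ℝ) ^ 2) ^ 2 := by
    intro t z
    simp_rw [hb, mul_pow]
    rw [← Finset.mul_sum, Fintype.sum_prod_type, sq (∑ i, (z i : ℝ) ^ 2), Finset.sum_mul_sum]
  have hbform : ∀ t z (g : Fin n × Fin n → ℝ), ∑ p, b t z p * g p =
      t * ((fun i => (z i : ℝ)) ⬝ᵥ (Matrix.of fun i j => g (i, j)) *ᵥ (fun i => (z i : ℝ))) := by
    intro t z g
    simp only [hb, Fintype.sum_prod_type, dotProduct, Matrix.mulVec, Matrix.of_apply,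
      Finset.mul_sum]
    exact Finset.sum_congr rfl fun i _ => Finset.sum_congr rfl fun j _ => by ring
  have hmgf : ∀ t, t ^ 2 = θ ^ 2 → ∀ z ∈ gridNet n,
      ∫ g, Real.exp (∑ p, b t z p * g p) ∂stdGaussianPi (Fin n × Fin n) ≤
        Real.exp (625 / 98 * n) := by
    intro t ht z hz
    rw [integral_exp_stdGaussianPi, hbsum, ht]
    refine Real.exp_le_exp.2 ?_
    have h1 : (∑ i, (z i : ℝ) ^ 2) ^ 2 ≤ (25 / 4 * n) ^ 2 :=
      pow_le_pow_left₀ (Finset.sum_nonneg fun _ _ => sq_nonneg _) (mem_gridNet.1 hz) 2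
    have h2 : θ ^ 2 * n = 16 / 49 := by
      rw [hθ, div_pow, mul_pow, hsn2]; field_simp; norm_num
    have h3 := mul_le_mul_of_nonneg_left h1 (sq_nonneg θ)
    have h4 : θ ^ 2 * (25 / 4 * n) ^ 2 = (θ ^ 2 * n) * (625 / 16) * n := by ring
    rw [h4, h2] at h3
    linarith
  have hint : ∀ z, Integrable (fun g : Fin n × Fin n → ℝ => Real.exp (∑ p, b θ z p * g p) +
      Real.exp (∑ p, b (-θ) z p * g p)) (stdGaussianPi (Fin n × Fin n)) := fun z =>
    (integrable_exp_stdGaussianPi _).add (integrable_exp_stdGaussianPi _)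
  refine ⟨fun g => ∑ z ∈ gridNet n,
    (Real.exp (∑ p, b θ z p * g p) + Real.exp (∑ p, b (-θ) z p * g p)), ?_, ?_, ?_⟩
  · exact integrable_finsetSum _ fun z _ => hint z
  · rw [integral_finsetSum _ fun z _ => hint z]
    calc _ ≤ ∑ z ∈ gridNet n, 2 * Real.exp (625 / 98 * n) := by
          refine Finset.sum_le_sum fun z hz => ?_
          rw [integral_add (integrable_exp_stdGaussianPi _) (integrable_exp_stdGaussianPi _)]
          linarith [hmgf θ rfl z hz, hmgf (-θ) (neg_sq θ) z hz]
      _ = (gridNet n).card * (2 * Real.exp (625 / 98 * n)) := by simp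
      _ ≤ (Real.exp (25 / 4 * n) * Real.exp 2 ^ n) *
            (Real.exp 1 ^ n * Real.exp (625 / 98 * n)) := by
          have h3 : (3 : ℝ) ≤ Real.exp 2 := by linarith [Real.add_one_le_exp (2 : ℝ)]
          have h2 : (2 : ℝ) ≤ Real.exp 1 := by linarith [Real.add_one_le_exp (1 : ℝ)]
          have h2' : (2 : ℝ) ≤ Real.exp 1 ^ n :=
            h2.trans (le_self_pow₀ (by linarith) hn.ne')
          have := card_gridNet_le n
          have h3' : (3 : ℝ) ^ n ≤ Real.exp 2 ^ n := by gcongr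
          exact mul_le_mul (this.trans (mul_le_mul_of_nonneg_left h3' (Real.exp_pos _).le))
            (mul_le_mul_of_nonneg_right h2' (Real.exp_pos _).le) (by positivity) (by positivity)
      _ ≤ Real.exp (16 * n) := by
          rw [← Real.exp_nat_mul, ← Real.exp_nat_mul, ← Real.exp_add, ← Real.exp_add,
            ← Real.exp_add]
          exact Real.exp_le_exp.2 (by linarith)
  · intro g
    obtain ⟨s, hs0, hs, z, hz, hzs⟩ := exists_mem_gridNet hn
      (transpose_symmPart (Matrix.of fun i j => g (i, j)))
    refine ⟨s, hs0, ?_, hs⟩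
    rw [dotProduct_symmPart_mulVec] at hzs
    set A := (fun i => (z i : ℝ)) ⬝ᵥ (Matrix.of fun i j => g (i, j)) *ᵥ (fun i => (z i : ℝ))
      with hA
    have hθ0 : 0 < θ := by positivity
    have h1 : √n * s ≤ θ * |A| := by
      have h2 : θ * (7 / 4 * n * s) = √n * s := by
        rw [hθ, div_mul_eq_mul_div, div_eq_iff (by positivity)]
        linear_combination (-7 * s) * hsn2
      rw [← h2]
      exact mul_le_mul_of_nonneg_left hzs hθ0.le
    refine le_trans ?_ (Finset.single_le_sum (f := fun z =>
      Real.exp (∑ p, b θ z p * g p) + Real.exp (∑ p, b (-θ) z p * g p))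
      (fun _ _ => by positivity) hz)
    simp only [hbform]
    rcases abs_cases A with ⟨h, _⟩ | ⟨h, _⟩
    · rw [h] at h1
      linarith [Real.exp_le_exp.2 h1, Real.exp_pos (-θ * A)]
    · rw [h, mul_neg, ← neg_mul] at h1
      linarith [Real.exp_le_exp.2 h1, Real.exp_pos (θ * A)]

/-! ### Inversion by rank-one updates -/

section RankOne
variable {n : Type*} [Fintype n] [DecidableEq n]

/-- The successive inverses of `1 + ∑ l < k, b l (b l)ᵀ`, by the Sherman–Morrison formula. -/
noncomputable def rankOneInverse (b : ℕ → n → ℝ) : ℕ → Matrix n n ℝ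
  | 0 => 1
  | k + 1 => rankOneInverse b k - (1 + b k ⬝ᵥ rankOneInverse b k *ᵥ b k)⁻¹ •
      Matrix.vecMulVec (rankOneInverse b k *ᵥ b k) (rankOneInverse b k *ᵥ b k)

/-- The Sherman–Morrison formula for a symmetric update of a positive definite matrix, for which
the denominator is at least `1`. -/
lemma inv_add_vecMulVec_self {A : Matrix n n ℝ} (hA : A.PosDef) (v : n → ℝ) :
    (A + Matrix.vecMulVec v v)⁻¹ =
      A⁻¹ - (1 + v ⬝ᵥ A⁻¹ *ᵥ v)⁻¹ • Matrix.vecMulVec (A⁻¹ *ᵥ v) (A⁻¹ *ᵥ v) := by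
  have hM := hA.inv
  have hMt : (A⁻¹)ᵀ = A⁻¹ := by
    have := hM.isHermitian.eq
    rwa [Matrix.conjTranspose_eq_transpose_of_trivial] at this
  have hAM : A * A⁻¹ = 1 := Matrix.mul_nonsing_inv _ ((Matrix.isUnit_iff_isUnit_det _).1 hA.isUnit)
  have hd : 0 < 1 + v ⬝ᵥ A⁻¹ *ᵥ v := by
    have := hM.posSemidef.dotProduct_mulVec_nonneg v
    rw [star_trivial] at this
    linarith
  refine Matrix.inv_eq_right_inv ?_
  set w := A⁻¹ *ᵥ v with hw
  have h1 : A *ᵥ w = v := by rw [hw, Matrix.mulVec_mulVec, hAM, Matrix.one_mulVec]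
  have h2 : v ᵥ* A⁻¹ = w := by rw [← Matrix.mulVec_transpose, hMt]
  rw [Matrix.mul_sub, Matrix.add_mul, Matrix.add_mul, hAM, Matrix.mul_smul, Matrix.mul_smul,
    Matrix.mul_vecMulVec, h1, Matrix.vecMulVec_mul, h2, Matrix.vecMulVec_mul_vecMulVec,
    ← smul_add]
  have h3 : Matrix.vecMulVec v w + Matrix.vecMulVec v ((v ⬝ᵥ w) • w) =
      (1 + v ⬝ᵥ w) • Matrix.vecMulVec v w := by
    rw [Matrix.vecMulVec_smul, add_smul, one_smul]
  rw [h3, smul_smul, inv_mul_cancel₀ hd.ne', one_smul, add_sub_cancel_right]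

lemma rankOneInverse_eq (b : ℕ → n → ℝ) (k : ℕ) :
    rankOneInverse b k = (1 + ∑ l ∈ Finset.range k, Matrix.vecMulVec (b l) (b l))⁻¹ := by
  induction k with
  | zero => simp [rankOneInverse]
  | succ k ih =>
    have hpos : (1 + ∑ l ∈ Finset.range k, Matrix.vecMulVec (b l) (b l)).PosDef := by
      refine Matrix.PosDef.one.add_posSemidef (Matrix.posSemidef_sum _ fun l _ => ?_)
      have := Matrix.posSemidef_vecMulVec_self_star (b l)
      rwa [star_trivial] at this
    rw [rankOneInverse, ih, Finset.sum_range_succ, ← add_assoc, inv_add_vecMulVec_self hpos]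

end RankOne

/-! ### The program -/

namespace RealRAM

/-- `A[c] := A[a] * A[b]`, for square matrices. -/
def matMul (c a b : ℕ) : Program :=
  fillSum c (.reg 0) (.mul (entry a 2 4) (entry b 4 3))

/-- `A[a] := 1`, the identity matrix. The Kronecker delta is expressed by truncated subtraction of indices. -/
def fillOne (a : ℕ) : Program :=
  fill a (.ofIndex (.sub (.lit 1) (.add (.sub (.reg 2) (.reg 3)) (.sub (.reg 3) (.reg 2)))))

/-- `A[6] := A[5] ^ (n + 3)`, where `n` is the content of register `0`. -/
def matPow : Program :=
  .seq (fillOne 6)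
    (.loop 5 (.add (.reg 0) (.lit 3)) (.seq (matMul 7 6 5) (fill 6 (entry 7 2 3))))

/-- `A[8] := (1 + A[6] A[6]ᵀ)⁻¹`, by one rank-one update for each column of `A[6]`. -/
def gramInverse : Program :=
  .seq (fillOne 8)
    (.loop 5 (.reg 0)
      (.seq (matMul 7 8 6)
        (.seq (fillSum 9 (.reg 0) (.mul (entry 6 4 5) (entry 7 4 5)))
          (.seq (fill 10 (.sub (entry 8 2 3) (.div (.mul (entry 7 2 5) (entry 7 3 5))
              (.add (.ofIndex (.lit 1)) (entry 9 2 3)))))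
            (fill 8 (entry 10 2 3))))))

/-- The scale of the noise. -/
def sigmaCell : RExp := .cell 0 (.lit 0) (.lit 3)

/-- The threshold of the spectral filter. -/
def thresholdCell : RExp := .cell 0 (.lit 0) (.lit 4)

/-- Perturb the Gram matrix by the noise in `A[3]`, symmetrize, and apply the spectral filter. -/
def denoiseProgram : Program :=
  .seq (fillSum 4 (.reg 1) (.mul (entry 1 2 4) (entry 1 3 4)))
  (.seq (fill 5 (.div (.add (.add (entry 4 2 3) (.mul sigmaCell (entry 3 2 3)))
      (.add (entry 4 3 2) (.mul sigmaCell (entry 3 3 2))))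
      (.mul (.ofIndex (.lit 2)) thresholdCell)))
  (.seq matPow
  (.seq gramInverse
  (.seq (matMul 7 5 8)
    (fill 2 (.mul thresholdCell (.sub (entry 5 2 3) (entry 7 2 3))))))))

/-- The mechanism: the spectral filter of the noisy Gram matrix, or zero if the noise exceeds
`√n`. -/
def mechanism : Program :=
  .seq (fillGauss 3)
  (.seq (.setCell 0 (.lit 0) (.lit 3)
    (.div (.mul (.mul (.ofIndex (.lit 2)) (.cell 0 (.lit 0) (.lit 2)))
      (.sqrt (.log (.div (.ofIndex (.lit 2)) (.cell 0 (.lit 0) (.lit 1))))))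
      (.cell 0 (.lit 0) (.lit 0))))
  (.seq (.setCell 0 (.lit 0) (.lit 4)
    (.mul (.mul (.ofIndex (.lit 128)) sigmaCell) (.sqrt (.ofIndex (.reg 0)))))
  (.ifLe sigmaCell (.sqrt (.ofIndex (.reg 0))) denoiseProgram .skip)))

lemma Program.run_seq (ω : ℕ → ℝ) (c d : Program) (s : State) :
    (Program.seq c d).run ω s = d.run ω (c.run ω s) := rfl

lemma mechanism_sizeBounded : mechanism.SizeBounded := by
  simp [mechanism, denoiseProgram, gramInverse, matPow, matMul, fillOne, fill, fillSum, fillGauss,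
    forEntries, Program.SizeBounded, IExp.IsSizeBound]

/-- The registers `0` and `1` and all arrays outside `A` have the same content in `s` and `t`. -/
structure Frame (A : Finset ℕ) (s t : State) : Prop where
  reg0 : t.reg 0 = s.reg 0
  reg1 : t.reg 1 = s.reg 1
  mem : ∀ b, b ∉ A → t.mem b = s.mem b

lemma Frame.trans {A : Finset ℕ} {s t u : State} (h : Frame A s t) (h' : Frame A t u) :
    Frame A s u :=
  ⟨h'.reg0.trans h.reg0, h'.reg1.trans h.reg1, fun b hb => (h'.mem b hb).trans (h.mem b hb)⟩

lemma SameOff.frame {A : Finset ℕ} {a : ℕ} {s t : State} (h : SameOff a s t) (ha : a ∈ A) :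
    Frame A s t :=
  ⟨h.reg 0 (by decide) (by decide) (by decide), h.reg 1 (by decide) (by decide) (by decide),
    fun b hb => h.mem b fun h => hb (h ▸ ha)⟩

/-- Array `a` holds the matrix `M`. -/
def Holds {n : ℕ} (s : State) (a : ℕ) (M : Matrix (Fin n) (Fin n) ℝ) : Prop :=
  ∀ i j : Fin n, s.mem a i j = M i j

lemma Holds.congr {n a : ℕ} {s t : State} {M : Matrix (Fin n) (Fin n) ℝ} (h : Holds s a M)
    (hst : t.mem a = s.mem a) : Holds t a M := fun i j => by rw [hst, h i j]

variable {ω : ℕ → ℝ} {n : ℕ} {s : State}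

lemma matMul_spec {c a b : ℕ} (hn : s.reg 0 = n) (ha : a ≠ c) (hb : b ≠ c)
    {M N : Matrix (Fin n) (Fin n) ℝ} (hM : Holds s a M) (hN : Holds s b N) :
    SameOff c s ((matMul c a b).run ω s) ∧ Holds ((matMul c a b).run ω s) c (M * N) := by
  obtain ⟨h1, h2⟩ := fillSum_spec (ω := ω) (a := c) (n := n) (m := n) (N := .reg 0)
    (e := .mul (entry a 2 4) (entry b 4 3)) (s := s) hn
    (fun i j k => s.mem a i k * s.mem b k j)
    (fun t ht => by
      rw [IExp.eval, ht.reg 0 (by decide) (by decide) (by decide), hn])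
    (fun t i j k _ _ _ ht h2 h3 h4 => by
      simp [entry, RExp.eval, IExp.eval, h2, h3, h4, ht.mem a ha, ht.mem b hb])
  refine ⟨h1, fun i j => ?_⟩
  rw [matMul, h2 i j i.2 j.2, Finset.sum_range, Matrix.mul_apply]
  exact Finset.sum_congr rfl fun k _ => by rw [hM, hN]

lemma fillOne_spec {a : ℕ} (hn : s.reg 0 = n) :
    SameOff a s ((fillOne a).run ω s) ∧
      Holds ((fillOne a).run ω s) a (1 : Matrix (Fin n) (Fin n) ℝ) := by
  obtain ⟨h1, h2⟩ := fill_spec (ω := ω) (a := a) (n := n) (s := s)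
    (e := .ofIndex (.sub (.lit 1) (.add (.sub (.reg 2) (.reg 3)) (.sub (.reg 3) (.reg 2))))) hn
    (fun i j => if i = j then 1 else 0)
    (fun t i j _ _ _ h2 h3 => by
      simp only [RExp.eval, IExp.eval, h2, h3]
      split_ifs with h
      · simp [h]
      · rw [show 1 - (i - j + (j - i)) = 0 by omega, Nat.cast_zero])
  refine ⟨h1, fun i j => ?_⟩
  rw [fillOne, h2 i j i.2 j.2, Matrix.one_apply]
  simp [Fin.ext_iff]

lemma copy_spec {c a : ℕ} (hn : s.reg 0 = n) (ha : a ≠ c)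
    {M : Matrix (Fin n) (Fin n) ℝ} (hM : Holds s a M) :
    SameOff c s ((fill c (entry a 2 3)).run ω s) ∧ Holds ((fill c (entry a 2 3)).run ω s) c M := by
  obtain ⟨h1, h2⟩ := fill_spec (ω := ω) (a := c) (n := n) (s := s) (e := entry a 2 3) hn (s.mem a)
    (fun t i j _ _ ht h2 h3 => by simp [entry, RExp.eval, IExp.eval, h2, h3, ht.mem a ha])
  exact ⟨h1, fun i j => by rw [h2 i j i.2 j.2, hM]⟩

lemma setReg_tick_frame (A : Finset ℕ) (s : State) {x : ℕ} (hx0 : x ≠ 0) (hx1 : x ≠ 1)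
    (k c : ℕ) : Frame A s ((s.setReg x k).tick c) :=
  ⟨by simp [State.tick, State.setReg, hx0.symm], by simp [State.tick, State.setReg, hx1.symm],
    fun _ _ => rfl⟩

lemma matPow_spec (hn : s.reg 0 = n) {Z : Matrix (Fin n) (Fin n) ℝ} (hZ : Holds s 5 Z) :
    Frame {6, 7} s (matPow.run ω s) ∧ Holds (matPow.run ω s) 6 (Z ^ (n + 3)) := by
  rw [matPow, Program.run]
  obtain ⟨h1, h2⟩ := fillOne_spec (ω := ω) (a := 6) hn
  set u := (fillOne 6).run ω s
  have hsu : Frame {6, 7} s u := h1.frame (by decide)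
  have key := Program.run_loop_induction (ω := ω) (x := 5) (e := .add (.reg 0) (.lit 3))
      (c := .seq (matMul 7 6 5) (fill 6 (entry 7 2 3))) (s := u)
    (fun k t => Frame {6, 7} s t ∧ Holds t 6 (Z ^ k))
    ⟨⟨hsu.reg0, hsu.reg1, hsu.mem⟩, by rw [pow_zero]; exact h2.congr rfl⟩ ?_
  · rwa [show (IExp.add (.reg 0) (.lit 3)).eval u = n + 3 by
      simp [IExp.eval, hsu.reg0, hn]] at key
  · rintro k t - ⟨hst, ht⟩
    rw [Program.run]
    set v := (t.setReg 5 k).tick 1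
    have hsv : Frame {6, 7} s v := hst.trans (setReg_tick_frame _ t (by decide) (by decide) k 1)
    obtain ⟨a1, a2⟩ := matMul_spec (ω := ω) (c := 7) (a := 6) (b := 5) (hsv.reg0.trans hn)
      (by decide) (by decide) (ht.congr rfl : Holds v 6 (Z ^ k))
      (hZ.congr (hsv.mem 5 (by decide)))
    have hsw := hsv.trans (a1.frame (A := {6, 7}) (by decide))
    obtain ⟨b1, b2⟩ := copy_spec (ω := ω) (c := 6) (a := 7) (hsw.reg0.trans hn) (by decide) a2
    exact ⟨hsw.trans (b1.frame (by decide)), by rwa [pow_succ]⟩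

lemma gramInverse_spec (hn : s.reg 0 = n) {B : Matrix (Fin n) (Fin n) ℝ} (hB : Holds s 6 B) :
    Frame {7, 8, 9, 10} s (gramInverse.run ω s) ∧
      Holds (gramInverse.run ω s) 8 (1 + B * Bᵀ)⁻¹ := by
  rw [gramInverse, Program.run]
  obtain ⟨h1, h2⟩ := fillOne_spec (ω := ω) (a := 8) hn
  set u := (fillOne 8).run ω s
  have hsu : Frame {7, 8, 9, 10} s u := h1.frame (by decide)
  set b : ℕ → Fin n → ℝ := fun k i => s.mem 6 i k with hb
  have key := Program.run_loop_induction (ω := ω) (x := 5) (e := .reg 0)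
      (c := (.seq (matMul 7 8 6)
        (.seq (fillSum 9 (.reg 0) (.mul (entry 6 4 5) (entry 7 4 5)))
          (.seq (fill 10 (.sub (entry 8 2 3) (.div (.mul (entry 7 2 5) (entry 7 3 5))
              (.add (.ofIndex (.lit 1)) (entry 9 2 3)))))
            (fill 8 (entry 10 2 3)))))) (s := u)
    (fun k t => Frame {7, 8, 9, 10} s t ∧ Holds t 8 (rankOneInverse b k))
    ⟨⟨hsu.reg0, hsu.reg1, hsu.mem⟩, h2.congr rfl⟩ ?_
  · rw [show (IExp.reg 0).eval u = n by simp [IExp.eval, hsu.reg0, hn], rankOneInverse_eq] at key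
    have h3 : ∑ l ∈ Finset.range n, Matrix.vecMulVec (b l) (b l) = B * Bᵀ := by
      rw [Finset.sum_range]
      ext i j
      simp [Matrix.sum_apply, Matrix.mul_apply, Matrix.vecMulVec_apply, hb, hB _ _]
    rwa [h3] at key
  · rintro k t hk ⟨hst, ht⟩
    rw [show (IExp.reg 0).eval u = n by simp [IExp.eval, hsu.reg0, hn]] at hk
    set M := rankOneInverse b k with hM
    simp only [Program.run]
    set v := (t.setReg 5 k).tick 1
    have hv5 : v.reg 5 = k := by simp [v, State.tick, State.setReg]
    have hsv : Frame {7, 8, 9, 10} s v :=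
      hst.trans (setReg_tick_frame _ t (by decide) (by decide) k 1)
    have hv6 : v.mem 6 = s.mem 6 := hsv.mem 6 (by decide)
    obtain ⟨a1, a2⟩ := matMul_spec (ω := ω) (c := 7) (a := 8) (b := 6) (hsv.reg0.trans hn)
      (by decide) (by decide) (ht.congr rfl : Holds v 8 M) (hB.congr hv6)
    set w := (matMul 7 8 6).run ω v
    have hw5 : w.reg 5 = k := (a1.reg 5 (by decide) (by decide) (by decide)).trans hv5
    have hsw := hsv.trans (a1.frame (A := {7, 8, 9, 10}) (by decide))
    have hw7 : ∀ i : Fin n, w.mem 7 i k = (M *ᵥ b k) i := by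
      intro i
      refine (a2 i ⟨k, hk⟩).trans ?_
      simp only [Matrix.mul_apply, Matrix.mulVec, dotProduct, hb]
      exact Finset.sum_congr rfl fun l _ => by rw [hB l ⟨k, hk⟩]
    have hw6 : w.mem 6 = s.mem 6 := (a1.mem 6 (by decide)).trans hv6
    have hw8 : Holds w 8 M := ht.congr (a1.mem 8 (by decide))
    obtain ⟨c1, c2⟩ := fillSum_spec (ω := ω) (a := 9) (n := n) (m := n) (N := .reg 0)
      (e := .mul (entry 6 4 5) (entry 7 4 5)) (s := w) (hsw.reg0.trans hn)
      (fun _ _ l => s.mem 6 l k * w.mem 7 l k)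
      (fun t ht => by
        rw [IExp.eval, ht.reg 0 (by decide) (by decide) (by decide), hsw.reg0, hn])
      (fun t i j l _ _ _ ht _ _ h4 => by
        simp [entry, RExp.eval, IExp.eval, h4, ht.mem 6 (by decide), ht.mem 7 (by decide), hw6,
          ht.reg 5 (by decide) (by decide) (by decide), hw5])
    set x := (fillSum 9 (.reg 0) (.mul (entry 6 4 5) (entry 7 4 5))).run ω w
    have hx5 : x.reg 5 = k := (c1.reg 5 (by decide) (by decide) (by decide)).trans hw5
    have hsx := hsw.trans (c1.frame (A := {7, 8, 9, 10}) (by decide))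
    have hx9 : ∀ i j, i < n → j < n → x.mem 9 i j = b k ⬝ᵥ M *ᵥ b k := by
      intro i j hi hj
      rw [c2 i j hi hj, Finset.sum_range]
      exact Finset.sum_congr rfl fun l _ => by rw [hw7]
    obtain ⟨d1, d2⟩ := fill_spec (ω := ω) (a := 10) (n := n) (s := x)
      (e := .sub (entry 8 2 3) (.div (.mul (entry 7 2 5) (entry 7 3 5))
              (.add (.ofIndex (.lit 1)) (entry 9 2 3)))) (hsx.reg0.trans hn)
      (fun i j => w.mem 8 i j - w.mem 7 i k * w.mem 7 j k / (1 + x.mem 9 i j))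
      (fun t i j _ _ ht h2 h3 => by
        simp [entry, RExp.eval, IExp.eval, h2, h3, ht.mem 7 (by decide), ht.mem 8 (by decide),
          ht.mem 9 (by decide), c1.mem 7 (by decide), c1.mem 8 (by decide),
          ht.reg 5 (by decide) (by decide) (by decide), hx5])
    set y := (fill 10 (.sub (entry 8 2 3) (.div (.mul (entry 7 2 5) (entry 7 3 5))
              (.add (.ofIndex (.lit 1)) (entry 9 2 3))))).run ω x
    have hsy := hsx.trans (d1.frame (A := {7, 8, 9, 10}) (by decide))
    have hy : Holds y 10 (rankOneInverse b (k + 1)) := by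
      intro i j
      rw [d2 i j i.2 j.2, hx9 i j i.2 j.2, hw8, hw7, hw7, rankOneInverse]
      simp only [Matrix.sub_apply, Matrix.smul_apply, Matrix.vecMulVec_apply, smul_eq_mul, ← hM]
      ring
    obtain ⟨e1, e2⟩ := copy_spec (ω := ω) (c := 8) (a := 10) (hsy.reg0.trans hn) (by decide) hy
    exact ⟨hsy.trans (e1.frame (by decide)), e2⟩

end RealRAM

/-- The spectral filter at scale `l`, applied to the symmetric part. -/
noncomputable def denoise {n : ℕ} (q : ℕ) (l : ℝ) (W : Matrix (Fin n) (Fin n) ℝ) :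
    Matrix (Fin n) (Fin n) ℝ :=
  l • spectralFilter q (l⁻¹ • symmPart W)

/-- The standard deviation of the noise. -/
noncomputable def noiseScale (ε δ Δ : ℝ) : ℝ := 2 * Δ * √(Real.log (2 / δ)) / ε

/-- The matrix with the first `n ^ 2` draws as entries, row by row. -/
def drawMatrix (n : ℕ) (ω : ℕ → ℝ) : Matrix (Fin n) (Fin n) ℝ :=
  Matrix.of fun i j => ω (i * n + j)

namespace RealRAM

lemma denoiseProgram_spec {ω : ℕ → ℝ} {n m : ℕ} {s : State} {σ l : ℝ} (hn : s.reg 0 = n)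
    (hm : s.reg 1 = m) (hσ : s.mem 0 0 3 = σ) (hl : s.mem 0 0 4 = l)
    {V : Matrix (Fin n) (Fin m) ℝ} (hV : ∀ (i : Fin n) (j : Fin m), s.mem 1 i j = V i j)
    {G : Matrix (Fin n) (Fin n) ℝ} (hG : Holds s 3 G) :
    Holds (denoiseProgram.run ω s) 2 (denoise (n + 3) l (V * Vᵀ + σ • G)) := by
  simp only [denoiseProgram, Program.run]
  obtain ⟨a1, a2⟩ := fillSum_spec (ω := ω) (a := 4) (n := n) (m := m) (N := .reg 1)
    (e := .mul (entry 1 2 4) (entry 1 3 4)) (s := s) hn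
    (fun i j k => s.mem 1 i k * s.mem 1 j k)
    (fun t ht => by
      rw [IExp.eval, ht.reg 1 (by decide) (by decide) (by decide), hm])
    (fun t i j k _ _ _ ht h2 h3 h4 => by
      simp [entry, RExp.eval, IExp.eval, h2, h3, h4, ht.mem 1 (by decide)])
  set t := (fillSum 4 (.reg 1) (.mul (entry 1 2 4) (entry 1 3 4))).run ω s
  have hst : Frame {2, 4, 5, 6, 7, 8, 9, 10} s t := a1.frame (by decide)
  have ht4 : Holds t 4 (V * Vᵀ) := by
    intro i j
    rw [a2 i j i.2 j.2, Finset.sum_range, Matrix.mul_apply]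
    exact Finset.sum_congr rfl fun k _ => by rw [hV, hV, Matrix.transpose_apply]
  obtain ⟨b1, b2⟩ := fill_spec (ω := ω) (a := 5) (n := n) (s := t)
    (e := .div (.add (.add (entry 4 2 3) (.mul sigmaCell (entry 3 2 3)))
      (.add (entry 4 3 2) (.mul sigmaCell (entry 3 3 2))))
      (.mul (.ofIndex (.lit 2)) thresholdCell)) (hst.reg0.trans hn)
    (fun i j => (t.mem 4 i j + σ * s.mem 3 i j + (t.mem 4 j i + σ * s.mem 3 j i)) / (2 * l))
    (fun u i j _ _ hu h2 h3 => by
      simp [entry, sigmaCell, thresholdCell, RExp.eval, IExp.eval, h2, h3, hu.mem 4 (by decide),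
        hu.mem 0 (by decide), hu.mem 3 (by decide), hst.mem 0 (by decide), hst.mem 3 (by decide),
        hσ, hl])
  set u := (fill 5 (.div (.add (.add (entry 4 2 3) (.mul sigmaCell (entry 3 2 3)))
      (.add (entry 4 3 2) (.mul sigmaCell (entry 3 3 2))))
      (.mul (.ofIndex (.lit 2)) thresholdCell))).run ω t
  have hsu := hst.trans (b1.frame (A := {2, 4, 5, 6, 7, 8, 9, 10}) (by decide))
  set Z := l⁻¹ • symmPart (V * Vᵀ + σ • G) with hZ
  have hu5 : Holds u 5 Z := by
    intro i j
    rw [b2 i j i.2 j.2, ht4, ht4, hG, hG]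
    simp only [hZ, symmPart, Matrix.smul_apply, Matrix.add_apply, Matrix.transpose_apply,
      smul_eq_mul]
    rw [div_eq_mul_inv, mul_inv]
    ring
  have hZt : Zᵀ = Z := by rw [hZ, Matrix.transpose_smul, transpose_symmPart]
  obtain ⟨c1, c2⟩ := matPow_spec (ω := ω) (hsu.reg0.trans hn) hu5
  set v := matPow.run ω u
  obtain ⟨d1, d2⟩ := gramInverse_spec (ω := ω) (c1.reg0.trans (hsu.reg0.trans hn)) c2
  set w := gramInverse.run ω v
  have hw0 : w.reg 0 = n := d1.reg0.trans (c1.reg0.trans (hsu.reg0.trans hn))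
  have hw5 : Holds w 5 Z :=
    hu5.congr ((d1.mem 5 (by decide)).trans (c1.mem 5 (by decide)))
  rw [Matrix.transpose_pow, hZt] at d2
  obtain ⟨e1, e2⟩ := matMul_spec (ω := ω) (c := 7) (a := 5) (b := 8) hw0 (by decide) (by decide)
    hw5 d2
  set x := (matMul 7 5 8).run ω w
  have hx5 : Holds x 5 Z := hw5.congr (e1.mem 5 (by decide))
  have hx0 : x.mem 0 0 4 = l := by
    rw [e1.mem 0 (by decide), d1.mem 0 (by decide), c1.mem 0 (by decide), hsu.mem 0 (by decide), hl]
  obtain ⟨-, f2⟩ := fill_spec (ω := ω) (a := 2) (n := n) (s := x)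
    (e := .mul thresholdCell (.sub (entry 5 2 3) (entry 7 2 3)))
    ((e1.reg 0 (by decide) (by decide) (by decide)).trans hw0)
    (fun i j => l * (x.mem 5 i j - x.mem 7 i j))
    (fun u i j _ _ hu h2 h3 => by
      simp [entry, thresholdCell, RExp.eval, IExp.eval, h2, h3, hu.mem 5 (by decide),
        hu.mem 0 (by decide), hu.mem 7 (by decide), hx0])
  intro i j
  rw [f2 i j i.2 j.2, hx5, e2]
  rfl

/-- Writing a parameter cell `(0, j)` of array `0`. -/
lemma setCell_spec (ω : ℕ → ℝ) (s : State) (j : ℕ) (e : RExp) :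
    let t := (Program.setCell 0 (.lit 0) (.lit j) e).run ω s
    t.reg = s.reg ∧ (∀ b, b ≠ 0 → t.mem b = s.mem b) ∧ t.mem 0 0 j = e.eval s ∧
      ∀ j', j' ≠ j → t.mem 0 0 j' = s.mem 0 0 j' := by
  refine ⟨rfl, fun b hb => ?_, ?_, fun j' hj => ?_⟩
  · funext i' j'
    simp [Program.run, State.tick, State.setMem, hb]
  · simp [Program.run, State.tick, State.setMem, IExp.eval]
  · simp [Program.run, State.tick, State.setMem, IExp.eval, hj]

open Classical in
/-- The program computes the filtered noisy Gram matrix. -/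
theorem mechanism_output {n m : ℕ} (ε δ Δ : ℝ) (V : Matrix (Fin n) (Fin m) ℝ) (ω : ℕ → ℝ) :
    mechanism.output ε δ Δ V ω =
      if noiseScale ε δ Δ ≤ √n then
        denoise (n + 3) (128 * noiseScale ε δ Δ * √n) (V * Vᵀ + noiseScale ε δ Δ • drawMatrix n ω)
      else 0 := by
  set s := inputState ε δ Δ V with hs
  have hs0 : s.reg 0 = n := by simp [hs, inputState]
  have hs1 : s.reg 1 = m := by simp [hs, inputState]
  obtain ⟨a1, a2⟩ := fillGauss_spec (ω := ω) (a := 3) hs0 (by simp [hs, inputState])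
  have hout : mechanism.output ε δ Δ V ω =
      Matrix.of fun i j : Fin n => (mechanism.run ω s).mem 2 i j := rfl
  rw [hout]
  simp only [mechanism, Program.run_seq]
  generalize (fillGauss 3).run ω s = t at a1 a2 ⊢
  have ht0 : t.reg 0 = n := (a1.reg 0 (by decide) (by decide) (by decide)).trans hs0
  have ht1 : t.reg 1 = m := (a1.reg 1 (by decide) (by decide) (by decide)).trans hs1
  have htm0 : t.mem 0 = s.mem 0 := a1.mem 0 (by decide)
  obtain ⟨b1, b2, b3, b4⟩ := setCell_spec ω t 3
    (.div (.mul (.mul (.ofIndex (.lit 2)) (.cell 0 (.lit 0) (.lit 2)))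
      (.sqrt (.log (.div (.ofIndex (.lit 2)) (.cell 0 (.lit 0) (.lit 1))))))
      (.cell 0 (.lit 0) (.lit 0)))
  generalize Program.run ω (.setCell 0 (.lit 0) (.lit 3) _) t = u at b1 b2 b3 b4 ⊢
  have hσ : u.mem 0 0 3 = noiseScale ε δ Δ := by
    rw [b3]
    simp [RExp.eval, IExp.eval, htm0, hs, inputState, noiseScale]
  obtain ⟨c1, c2, c3, c4⟩ := setCell_spec ω u 4
    (.mul (.mul (.ofIndex (.lit 128)) sigmaCell) (.sqrt (.ofIndex (.reg 0))))
  generalize Program.run ω (.setCell 0 (.lit 0) (.lit 4) _) u = v at c1 c2 c3 c4 ⊢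
  have hv0 : v.reg 0 = n := by rw [c1, b1, ht0]
  have hvσ : v.mem 0 0 3 = noiseScale ε δ Δ := by rw [c4 3 (by decide), hσ]
  have hvl : v.mem 0 0 4 = 128 * noiseScale ε δ Δ * √n := by
    rw [c3]
    simp [RExp.eval, IExp.eval, sigmaCell, hσ, b1, ht0]
  rw [Program.run, show sigmaCell.eval v = noiseScale ε δ Δ from hvσ,
    show (RExp.sqrt (.ofIndex (.reg 0))).eval v = √n by simp [RExp.eval, IExp.eval, hv0]]
  split_ifs with h
  · obtain ⟨w, hwv, hwr, hwm⟩ : ∃ w, v.tick (sigmaCell.cost +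
        (RExp.sqrt (.ofIndex (.reg 0))).cost + 1) = w ∧ w.reg = v.reg ∧ w.mem = v.mem :=
      ⟨_, rfl, rfl, rfl⟩
    rw [hwv]
    have key : Holds (denoiseProgram.run ω w) 2 (denoise (n + 3)
        (128 * noiseScale ε δ Δ * √n) (V * Vᵀ + noiseScale ε δ Δ • drawMatrix n ω)) := by
      refine denoiseProgram_spec (by rw [hwr, hv0]) (by rw [hwr, c1, b1, ht1]) (by rw [hwm, hvσ])
        (by rw [hwm, hvl]) (fun i j => ?_) (fun i j => ?_)
      · rw [hwm, c2 1 (by decide), b2 1 (by decide), a1.mem 1 (by decide)]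
        simp [hs, inputState]
      · rw [hwm, c2 3 (by decide), b2 3 (by decide), a2 i j i.2 j.2, drawMatrix, Matrix.of_apply]
    ext i j
    rw [Matrix.of_apply, key i j]
  · ext i j
    change v.mem 2 i j = 0
    rw [c2 2 (by decide), b2 2 (by decide), a1.mem 2 (by decide)]
    simp [hs, inputState]

end RealRAM

/-! ### Privacy of the mechanism -/

instance {n : ℕ} : BorelSpace (Matrix (Fin n) (Fin n) ℝ) :=
  inferInstanceAs (BorelSpace (Fin n → Fin n → ℝ))

lemma measurable_matrix_iff {Ω : Type*} [MeasurableSpace Ω] {n : ℕ}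
    {f : Ω → Matrix (Fin n) (Fin n) ℝ} :
    Measurable f ↔ ∀ i j, Measurable fun x => f x i j :=
  measurable_pi_iff.trans (forall_congr' fun _ => measurable_pi_iff)

lemma measurable_matrix_inv {n : ℕ} :
    Measurable fun A : Matrix (Fin n) (Fin n) ℝ => A⁻¹ := by
  refine measurable_matrix_iff.2 fun i j => ?_
  simp only [Matrix.inv_def, Ring.inverse_eq_inv', Matrix.smul_apply, smul_eq_mul]
  have h1 : Continuous fun A : Matrix (Fin n) (Fin n) ℝ => A.det := continuous_id.matrix_det
  have h2 : Continuous fun A : Matrix (Fin n) (Fin n) ℝ => A.adjugate i j :=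
    continuous_id.matrix_adjugate.matrix_elem i j
  exact h1.measurable.inv.mul h2.measurable

lemma measurable_denoise {n : ℕ} (q : ℕ) (l : ℝ) :
    Measurable (denoise (n := n) q l) := by
  have hZ : Continuous fun W : Matrix (Fin n) (Fin n) ℝ => l⁻¹ • symmPart W  := by
    unfold symmPart
    fun_prop
  have hA : Continuous fun W : Matrix (Fin n) (Fin n) ℝ =>
      1 + (l⁻¹ • symmPart W) ^ q * (l⁻¹ • symmPart W) ^ q :=
    continuous_const.add ((hZ.pow q).mul (hZ.pow q))
  have hI := measurable_matrix_iff.1 (measurable_matrix_inv.comp hA.measurable)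
  have hZ' := measurable_matrix_iff.1 hZ.measurable
  refine measurable_matrix_iff.2 fun i j => ?_
  have h : ∀ W : Matrix (Fin n) (Fin n) ℝ, denoise q l W i j =
      l * ((l⁻¹ • symmPart W) i j - ∑ k, (l⁻¹ • symmPart W) i k *
        ((1 + (l⁻¹ • symmPart W) ^ q * (l⁻¹ • symmPart W) ^ q)⁻¹) k j) := fun W => rfl
  simp_rw [h]
  exact ((hZ' i j).sub (Finset.measurable_sum _ fun k _ => (hZ' i k).mul (hI k j))).const_mul _

lemma noiseScale_pos {ε δ Δ : ℝ} (hε : 0 < ε) (hδ : 0 < δ) (hδ1 : δ ≤ 1) (hΔ : 0 < Δ) :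
    0 < noiseScale ε δ Δ := by
  have : 0 < Real.log (2 / δ) := Real.log_pos (by rw [lt_div_iff₀ hδ]; linarith)
  unfold noiseScale
  positivity

/-- Row by row numbering of the entries of a square matrix. -/
def entryIndex (n : ℕ) (p : Fin n × Fin n) : ℕ := p.1 * n + p.2

lemma entryIndex_injective (n : ℕ) : (entryIndex n).Injective := by
  rintro ⟨i, j⟩ ⟨i', j'⟩ h
  have h1 : (i : ℕ) * n + j = i' * n + j' := h
  have h2 := congrArg (· % n) h1
  have h3 := congrArg (· / n) h1
  have hn : 0 < n := i.pos
  simp only [mul_comm _ n, Nat.mul_add_mod, Nat.mod_eq_of_lt j.2, Nat.mod_eq_of_lt j'.2] at h2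
  simp only [mul_comm _ n, Nat.mul_add_div hn, Nat.div_eq_of_lt j.2, Nat.div_eq_of_lt j'.2,
    add_zero] at h3
  exact Prod.ext (Fin.ext h3) (Fin.ext h2)

/-- The Gaussian mechanism for the Gram matrix, followed by any measurable map, is private. -/
theorem isDifferentiallyPrivate_gaussian_gram {n m : ℕ} {ε δ Δ : ℝ} (hε : 0 < ε) (hε1 : ε ≤ 1)
    (hδ : 0 < δ) (hδ1 : δ ≤ 1) (hΔ : 0 < Δ)
    {g : Matrix (Fin n) (Fin n) ℝ → Matrix (Fin n) (Fin n) ℝ} (hg : Measurable g) :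
    IsDifferentiallyPrivate RealRAM.randomness (GramAdjacent Δ)
      (fun (V : Matrix (Fin n) (Fin m) ℝ) ω =>
        g (V * Vᵀ + noiseScale ε δ Δ • drawMatrix n ω)) ε δ := by
  have hσ := noiseScale_pos hε hδ hδ1 hΔ
  set σ := noiseScale ε δ Δ with hσdef
  have hmp := measurePreserving_randomness (entryIndex_injective n)
  -- the mechanism as a function of the Gaussian vector
  set h : Matrix (Fin n) (Fin m) ℝ → (Fin n × Fin n → ℝ) → Matrix (Fin n) (Fin n) ℝ :=
    fun V x => g (V * Vᵀ + σ • Matrix.of fun i j => x (i, j)) with hh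
  have hhm : ∀ V, Measurable (h V) := by
    intro V
    refine hg.comp (measurable_matrix_iff.2 fun i j => ?_)
    simp only [Matrix.add_apply, Matrix.smul_apply, Matrix.of_apply, smul_eq_mul]
    fun_prop
  have hrun : ∀ V ω, g (V * Vᵀ + σ • drawMatrix n ω) = h V (fun p => ω (entryIndex n p)) :=
    fun V ω => rfl
  simp_rw [hrun]
  refine ⟨fun V => (hhm V).comp hmp.measurable, fun u v huv S hS => ?_⟩
  have hpre : ∀ V, RealRAM.randomness {ω | h V (fun p => ω (entryIndex n p)) ∈ S} =
      stdGaussianPi (Fin n × Fin n) (h V ⁻¹' S) := fun V =>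
    hmp.measure_preimage (hhm V hS).nullMeasurableSet
  rw [hpre, hpre]
  set a : Fin n × Fin n → ℝ := fun p => σ⁻¹ * (u * uᵀ - v * vᵀ) p.1 p.2 with ha
  have hshift : h u ⁻¹' S = (· + a) ⁻¹' (h v ⁻¹' S) := by
    ext x
    have : h u x = h v (x + a) := by
      simp only [hh]
      congr 1
      ext i j
      simp only [ha, Matrix.add_apply, Matrix.smul_apply, Matrix.of_apply, smul_eq_mul,
        Pi.add_apply, Matrix.sub_apply]
      field_simp
      ring
    simp [this]
  rw [hshift, ← Measure.map_apply (by fun_prop) (hhm v hS)]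
  refine stdGaussianPi_map_add_le hε hε1 hδ hδ1 a ?_ (hhm v hS)
  have hL : 0 < Real.log (2 / δ) := Real.log_pos (by rw [lt_div_iff₀ hδ]; linarith)
  have hsum : ∑ p, a p ^ 2 = (σ⁻¹) ^ 2 * ‖u * uᵀ - v * vᵀ‖ ^ 2 := by
    rw [frobenius_norm_sq, Fintype.sum_prod_type]
    simp_rw [ha, mul_pow, ← Finset.mul_sum]
  have hle : ‖u * uᵀ - v * vᵀ‖ ^ 2 ≤ Δ ^ 2 := pow_le_pow_left₀ (norm_nonneg _) huv 2
  have hσ2 : σ ^ 2 * ε ^ 2 = 4 * Δ ^ 2 * Real.log (2 / δ) := by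
    rw [hσdef, noiseScale, div_pow, div_mul_cancel₀ _ (by positivity), mul_pow,
      Real.sq_sqrt hL.le]
    ring
  rw [hsum, inv_pow]
  calc 4 * ((σ ^ 2)⁻¹ * ‖u * uᵀ - v * vᵀ‖ ^ 2) * Real.log (2 / δ)
      ≤ 4 * ((σ ^ 2)⁻¹ * Δ ^ 2) * Real.log (2 / δ) := by gcongr
    _ = (σ ^ 2)⁻¹ * (σ ^ 2 * ε ^ 2) := by rw [hσ2]; ring
    _ = ε ^ 2 := by field_simp

lemma isDifferentiallyPrivate_const {𝒱 Ω 𝒪 : Type*} [MeasurableSpace Ω] [MeasurableSpace 𝒪]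
    (μ : Measure Ω) (adj : 𝒱 → 𝒱 → Prop) (c : 𝒪) {ε δ : ℝ} (hε : 0 ≤ ε) :
    IsDifferentiallyPrivate μ adj (fun _ _ => c) ε δ := by
  refine ⟨fun _ => measurable_const, fun u v _ S _ => le_add_of_le_of_nonneg ?_ zero_le⟩
  refine le_mul_of_one_le_left zero_le ?_
  rw [← ENNReal.ofReal_one]
  exact ENNReal.ofReal_le_ofReal (Real.one_le_exp hε)

open Classical in
theorem mechanism_isDifferentiallyPrivate {n m : ℕ} {ε δ Δ : ℝ} (hε : 0 < ε) (hε1 : ε ≤ 1)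
    (hδ : 0 < δ) (hδ1 : δ ≤ 1) (hΔ : 0 < Δ) :
    IsDifferentiallyPrivate RealRAM.randomness (GramAdjacent Δ)
      (fun V : Matrix (Fin n) (Fin m) ℝ => RealRAM.mechanism.output ε δ Δ V) ε δ := by
  have h : (fun V : Matrix (Fin n) (Fin m) ℝ => RealRAM.mechanism.output ε δ Δ V) =
      fun V ω => if noiseScale ε δ Δ ≤ √n then denoise (n + 3) (128 * noiseScale ε δ Δ * √n)
        (V * Vᵀ + noiseScale ε δ Δ • drawMatrix n ω) else 0 := by
    funext V ω
    exact RealRAM.mechanism_output ε δ Δ V ω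
  rw [h]
  split_ifs
  · exact isDifferentiallyPrivate_gaussian_gram hε hε1 hδ hδ1 hΔ (measurable_denoise _ _)
  · exact isDifferentiallyPrivate_const _ _ _ hε.le

/-! ### Utility of the mechanism -/

section Utility
variable {n m : ℕ} {V : Matrix (Fin n) (Fin m) ℝ}

lemma norm_gram_sq_le (hV : ∀ i, ∑ j, V i j ^ 2 = 1) : ‖V * Vᵀ‖ ^ 2 ≤ (n : ℝ) ^ 2 := by
  rw [frobenius_norm_sq]
  calc ∑ i, ∑ j, (V * Vᵀ) i j ^ 2 ≤ ∑ _i : Fin n, ∑ _j : Fin n, (1 : ℝ) := by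
        refine Finset.sum_le_sum fun i _ => Finset.sum_le_sum fun j _ => ?_
        have := Finset.sum_mul_sq_le_sq_mul_sq Finset.univ (V i) (V j)
        rwa [hV, hV, one_mul] at this
    _ = _ := by simp [sq]

lemma rpow_three_halves (n : ℕ) : (n : ℝ) ^ (3 / 2 : ℝ) = n * √n := by
  rcases Nat.eq_zero_or_pos n with rfl | hn
  · norm_num
  · rw [Real.sqrt_eq_rpow, show (3 / 2 : ℝ) = 1 + 1 / 2 by norm_num,
      Real.rpow_add (by exact_mod_cast hn), Real.rpow_one]

/-- The error on every outcome. The exponential moment `y` takes over on the outcomes where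
the noise, of norm `σ s`, is too large for the threshold `128 σ √n`. -/
lemma norm_sub_denoise_sq_le {σ : ℝ} (hV : ∀ i, ∑ j, V i j ^ 2 = 1) (hn : 0 < n) (hσ : 0 < σ)
    (hσn : σ ≤ √n) {G : Matrix (Fin n) (Fin n) ℝ} {s y : ℝ} (hs0 : 0 ≤ s)
    (hs : ∀ v : Fin n → ℝ, |v ⬝ᵥ symmPart G *ᵥ v| ≤ s * ∑ i, v i ^ 2)
    (hy : Real.exp (√n * s) ≤ y) :
    ‖V * Vᵀ - denoise (n + 3) (128 * σ * √n) (V * Vᵀ + σ • G)‖ ^ 2 ≤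
      640 * σ * (n * √n) + 120 * σ * √n * Real.exp (-(16 * n)) * y := by
  have hn' : (1 : ℝ) ≤ n := by exact_mod_cast hn
  have hr1 : 1 ≤ √(n : ℝ) := Real.one_le_sqrt.2 hn'
  have hr2 : √(n : ℝ) ^ 2 = n := Real.sq_sqrt (by positivity)
  set r := √(n : ℝ) with hr
  set l := 128 * σ * r with hl
  have hl0 : 0 < l := by positivity
  set E := σ • symmPart G with hE
  have hEt : Eᵀ = E := by rw [hE, Matrix.transpose_smul, transpose_symmPart]
  have hsym : symmPart (V * Vᵀ + σ • G) = V * Vᵀ + E := by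
    ext i j
    have h1 : (V * Vᵀ) j i = (V * Vᵀ) i j := by
      simp [Matrix.mul_apply, mul_comm]
    simp only [symmPart, hE, Matrix.smul_apply, Matrix.add_apply, Matrix.transpose_apply,
      smul_eq_mul, h1]
    ring
  have he : ∀ v : Fin n → ℝ, |v ⬝ᵥ E *ᵥ v| ≤ σ * s * ∑ i, v i ^ 2 := by
    intro v
    rw [hE, Matrix.smul_mulVec, dotProduct_smul, smul_eq_mul, abs_mul, abs_of_pos hσ, mul_assoc]
    exact mul_le_mul_of_nonneg_left (hs v) hσ.le
  have he0 : 0 ≤ σ * s := by positivity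
  have hy0 : 0 ≤ y := (Real.exp_pos _).le.trans hy
  have hden : denoise (n + 3) l (V * Vᵀ + σ • G) =
      l • spectralFilter (n + 3) (l⁻¹ • (V * Vᵀ + E)) := by rw [denoise, hsym]
  rw [hden]
  rcases le_or_gt (σ * s) (l / 4) with h | h
  · -- `128 = 2 * 4 ^ 3`, and `σ √n ≤ n ≤ 4 ^ n`
    have hlq : l ≤ 2 * 4 ^ (n + 3) := by
      have h1 : (n : ℝ) ≤ 4 ^ n := by exact_mod_cast (Nat.lt_pow_self (by norm_num)).le
      have h2 : σ * r ≤ n := by nlinarith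
      rw [pow_add]
      linarith
    have := norm_sub_spectralFilter_sq_le_of_le hV hEt he he0 hl0 (by omega) h hlq
    rw [Fintype.card_fin] at this
    have h3 : 0 ≤ 120 * σ * r * Real.exp (-(16 * n)) * y := by positivity
    calc _ ≤ 5 * l * n := this
      _ = 640 * σ * (n * r) := by rw [hl]; ring
      _ ≤ _ := by linarith
  · have := norm_sub_spectralFilter_sq_le_of_noise hV hEt he he0 hl0 (q := n + 3) (by omega)
    rw [Fintype.card_fin] at this
    set t := r * s with ht
    have hs32 : 32 * r < s := by
      have : σ * (32 * r) < σ * s := by linarith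
      exact lt_of_mul_lt_mul_left this hσ.le
    have ht32 : 32 * n ≤ t := by nlinarith
    have ht1 : t ≤ t ^ 2 := by nlinarith
    -- as `16 n ≤ t / 2`, the factor `exp (-16 n)` leaves `exp (t / 2)` to dominate `t ^ 2`
    have ht2 : t ^ 2 ≤ 8 * (Real.exp (-(16 * n)) * y) := by
      have h1 := Real.quadratic_le_exp_of_nonneg (x := t / 2) (by linarith)
      have h2 : Real.exp (t / 2) ≤ Real.exp (-(16 * n)) * y := by
        calc Real.exp (t / 2) ≤ Real.exp (-(16 * n) + t) := Real.exp_le_exp.2 (by linarith)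
          _ ≤ _ := by
            rw [Real.exp_add]
            exact mul_le_mul_of_nonneg_left hy (Real.exp_pos _).le
      nlinarith
    have hns : n * s = r * t := by rw [ht, ← hr2]; ring
    have hns2 : n * s ^ 2 = t ^ 2 := by rw [ht, mul_pow, hr2]
    have h3 : 0 ≤ 640 * σ * (n * r) := by positivity
    calc _ ≤ (l + σ * s) * ((2 + σ * s) * n) := this
      _ ≤ 5 * (σ * s) * ((2 + σ * s) * n) := by
          refine mul_le_mul_of_nonneg_right (by linarith) (by positivity)
      _ = 10 * σ * (n * s) + 5 * σ * σ * (n * s ^ 2) := by ring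
      _ = 10 * σ * r * t + 5 * σ * σ * t ^ 2 := by rw [hns, hns2]; ring
      _ ≤ 10 * σ * r * t ^ 2 + 5 * σ * r * t ^ 2 := by gcongr
      _ = 15 * σ * r * t ^ 2 := by ring
      _ ≤ 15 * σ * r * (8 * (Real.exp (-(16 * n)) * y)) := by gcongr
      _ ≤ _ := by linarith

open Classical in
/-- If `σ ≤ √n`, integrate the bound on every outcome; otherwise the output is `0`. -/
theorem mechanism_utility {ε δ Δ : ℝ} (hε : 0 < ε) (hε1 : ε ≤ 1) (hδ : 0 < δ) (hδ1 : δ ≤ 1)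
    (hΔ : 0 < Δ) (hV : ∀ i, ∑ j, V i j ^ 2 = 1) :
    Integrable (fun ω => ‖V * Vᵀ - RealRAM.mechanism.output ε δ Δ V ω‖ ^ 2) RealRAM.randomness ∧
      ∫ ω, ‖V * Vᵀ - RealRAM.mechanism.output ε δ Δ V ω‖ ^ 2 ∂(RealRAM.randomness)
        ≤ 760 * noiseScale ε δ Δ * (n * √n) := by
  have hσ := noiseScale_pos hε hδ hδ1 hΔ
  have hmeas : Measurable fun ω => ‖V * Vᵀ - RealRAM.mechanism.output ε δ Δ V ω‖ ^ 2 := by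
    have h1 := measurable_matrix_iff.1
      ((mechanism_isDifferentiallyPrivate (n := n) (m := m) hε hε1 hδ hδ1 hΔ).1 V)
    simp_rw [frobenius_norm_sq]
    exact Finset.measurable_sum _ fun i _ => Finset.measurable_sum _ fun j _ =>
      (measurable_const.sub (h1 i j)).pow_const 2
  have hout : ∀ ω, RealRAM.mechanism.output ε δ Δ V ω = _ := RealRAM.mechanism_output ε δ Δ V
  by_cases hσn : noiseScale ε δ Δ ≤ √n
  · have hn : 0 < n := by
      rcases Nat.eq_zero_or_pos n with rfl | hn
      · simp at hσn; linarith
      · exact hn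
    obtain ⟨Φ, hΦint, hΦ, hbound⟩ := exists_integrable_exp_norm_symmPart_le hn
    have hmp := measurePreserving_randomness (entryIndex_injective n)
    set σ := noiseScale ε δ Δ
    set π : (ℕ → ℝ) → Fin n × Fin n → ℝ := fun ω p => ω (entryIndex n p)
    have hΦπ : Integrable (fun ω => Φ (π ω)) RealRAM.randomness :=
      hmp.integrable_comp_of_integrable hΦint
    have hΦπ' : ∫ ω, Φ (π ω) ∂(RealRAM.randomness) = ∫ x, Φ x ∂stdGaussianPi (Fin n × Fin n) := by
      rw [← hmp.map_eq] at hΦint ⊢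
      exact (integral_map hmp.measurable.aemeasurable hΦint.aestronglyMeasurable).symm
    set c := 120 * σ * √n * Real.exp (-(16 * n)) with hc
    have hpt : ∀ ω, ‖V * Vᵀ - RealRAM.mechanism.output ε δ Δ V ω‖ ^ 2 ≤
        640 * σ * (n * √n) + c * Φ (π ω) := by
      intro ω
      rw [hout, if_pos hσn]
      obtain ⟨s, hs0, hsΦ, hs⟩ := hbound (π ω)
      exact norm_sub_denoise_sq_le hV hn hσ hσn hs0 hs hsΦ
    have hdom : Integrable (fun ω => 640 * σ * (n * √n) + c * Φ (π ω)) RealRAM.randomness :=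
      (integrable_const _).add (hΦπ.const_mul _)
    have hint : Integrable (fun ω => ‖V * Vᵀ - RealRAM.mechanism.output ε δ Δ V ω‖ ^ 2)
        RealRAM.randomness := by
      refine hdom.mono' hmeas.aestronglyMeasurable (Filter.Eventually.of_forall fun ω => ?_)
      rw [Real.norm_of_nonneg (by positivity)]
      exact hpt ω
    refine ⟨hint, (integral_mono hint hdom hpt).trans ?_⟩
    rw [integral_add (integrable_const _) (hΦπ.const_mul _), integral_const_mul c, hΦπ']
    have h1 : c * ∫ x, Φ x ∂stdGaussianPi (Fin n × Fin n) ≤ 120 * σ * √n := by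
      calc _ ≤ c * Real.exp (16 * n) := mul_le_mul_of_nonneg_left hΦ (by positivity)
        _ = 120 * σ * √n := by rw [hc, mul_assoc, ← Real.exp_add]; simp
    have h2 : 120 * σ * √n ≤ 120 * σ * (n * √n) := by
      have : (1 : ℝ) ≤ n := by exact_mod_cast hn
      have h3 : √(n : ℝ) ≤ n * √n := le_mul_of_one_le_left (by positivity) this
      gcongr
    simp only [integral_const, probReal_univ, one_smul]
    linarith
  · simp_rw [hout, if_neg hσn, sub_zero]
    refine ⟨integrable_const _, ?_⟩
    rw [integral_const, probReal_univ, one_smul]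
    have h1 : √(n : ℝ) * √n = n := Real.mul_self_sqrt (by positivity)
    calc ‖V * Vᵀ‖ ^ 2 ≤ (n : ℝ) ^ 2 := norm_gram_sq_le hV
      _ = √n * (n * √n) := by linear_combination (-(n : ℝ)) * h1
      _ ≤ noiseScale ε δ Δ * (n * √n) := by gcongr; exact (not_le.1 hσn).le
      _ ≤ 760 * noiseScale ε δ Δ * (n * √n) := by
          have : 0 ≤ noiseScale ε δ Δ * (n * √n) := by positivity
          linarith

end Utility

theorem mainTheorem2 :
    ∃ (P : RealRAM.Program) (C : ℝ) (p : Polynomial ℕ),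
      ∀ (n m : ℕ) (ε δ Δ : ℝ), 0 < ε → ε ≤ 1 → 0 < δ → δ ≤ 1 → 0 < Δ →
        -- privacy
        IsDifferentiallyPrivate RealRAM.randomness (GramAdjacent Δ)
          (fun V : Matrix (Fin n) (Fin m) ℝ => P.output ε δ Δ V) ε δ ∧
        -- utility on sets of unit vectors
        (∀ V : Matrix (Fin n) (Fin m) ℝ, (∀ i, ∑ j, V i j ^ 2 = 1) →
          Integrable (fun ω => ‖V * Vᵀ - P.output ε δ Δ V ω‖ ^ 2) RealRAM.randomness ∧
          ∫ ω, ‖V * Vᵀ - P.output ε δ Δ V ω‖ ^ 2 ∂(RealRAM.randomness)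
            ≤ C * (Δ * Real.sqrt (Real.log (2 / δ)) / ε) * (n : ℝ) ^ (3 / 2 : ℝ)) ∧
        -- running time, in the worst case
        (∀ (V : Matrix (Fin n) (Fin m) ℝ) (ω : ℕ → ℝ),
          P.runningTime ε δ Δ V ω ≤ p.eval (n + m)) := by
  obtain ⟨p, hp⟩ := RealRAM.mechanism_sizeBounded.exists_polynomial
  refine ⟨RealRAM.mechanism, 1520, p, fun n m ε δ Δ hε hε1 hδ hδ1 hΔ =>
    ⟨mechanism_isDifferentiallyPrivate hε hε1 hδ hδ1 hΔ, fun V hV => ?_, fun V ω => ?_⟩⟩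
  · obtain ⟨h1, h2⟩ := mechanism_utility hε hε1 hδ hδ1 hΔ hV
    refine ⟨h1, h2.trans_eq ?_⟩
    rw [rpow_three_halves, noiseScale]
    ring
  · have h := (hp ω (RealRAM.inputState ε δ Δ V)).2.2
    simpa [RealRAM.inputState, RealRAM.Program.runningTime] using h
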